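/- Let $k$ be a commutative Artinian ring and $A$ an Artin $k$-algebra (a $k$-algebra that is finitely generated as a $k$-module). All modules are finitely generated left $A$-modules; $\mathrm{add}(\mathcal C)$ consists of the direct summands of finite direct sums of modules in a class $\mathcal C$, and $\mathrm{add}(U)=\mathrm{add}(\{U\})$; $\Omega(X)$ is the kernel of a projective cover of $X$, $\Omega^0(X)=X$ and $\Omega^{n+1}(X)=\Omega(\Omega^{n}(X))$; $\mathrm{rad}(M)$ is the intersection of the maximal submodules of $M$, and $\mathrm{top}(M)=M/\mathrm{rad}(M)$. For integers $m,n\ge 0$, $A$ is an $(m,n)$-Igusa–Todorov algebra if there is a module $U$ such that for every module $X$ there is an exact sequence $$0\to U_m\to\cdots\to U_1\to U_0\to\Omega^n(X)\to 0,\qquad U_i\in\mathrm{add}(U).$$ The Igusa–Todorov distance of $A$ is $\mathrm{IT.dist}(A)=\inf\{m\ge 0\mid A\text{ is an }(m,n)\text{-Igusa–Todorov algebra for some }n\ge 0\}\in\mathbb N\cup\{\infty\}$. For a set $\mathcal V$ of simple modules, considered up to isomorphism, let $\mathcal V'$ be the class of the simple modules not isomorphic to a member of $\mathcal V$, let $\mathfrak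 T(\mathcal V)=\{M\mid \mathrm{top}(M)\in\mathrm{add}(\mathcal V')\}$, and let $t_{\mathcal V}(M)$ be the largest submodule of $M$ that lies in $\mathfrak T(\mathcal V)$. Put $F_{t_{\mathcal V}}(M)=\mathrm{rad}(t_{\mathcal V}(M))$ and define the $t_{\mathcal V}$-radical layer length $\ell\ell^{t_{\mathcal V}}(M)=\inf\{i\ge 0\mid t_{\mathcal V}(F_{t_{\mathcal V}}^{i}(M))=0\}$. The Loewy length is $\ell\ell(M)=\inf\{i\ge 0\mid \mathrm{rad}^i(M)=0\}$. **Theorem.** For every Artin algebra $A$ and every set $\mathcal V$ of simple $A$-modules of finite projective dimension, $$\mathrm{IT.dist}(A)\le\max\{\ell\ell^{t_{\mathcal V}}(A)-2,\,0\},$$ where the layer length is that of $A$ as a left module over itself. In particular $$\mathrm{IT.dist}(A)\le\max\{\ell\ell(A)-2,\,0\},$$ and $\mathrm{IT.dist}(A)<\infty$. -/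

import Mathlib

/-!
Modules are left modules. For a ring `A` in `Type v`, the category `A`-mod is represented by the
objects `X : ModuleCat.{v} A` with `Module.Finite A X`; every finitely generated `A`-module has an
isomorphic copy there. Classes of modules are sets of objects.
-/

universe u v

namespace IgusaTodorov

variable {A : Type v} [Ring A]

/-- `M` lies in `add C`: it is isomorphic to a direct summand of a finite direct sum of modules
from `C`. -/
def InAdd (C : Set (ModuleCat.{v} A)) (M : ModuleCat.{v} A) : Prop :=
  ∃ (n : ℕ) (F : Fin n → ModuleCat.{v} A) (N : ModuleCat.{v} A),
    (∀ i, F i ∈ C) ∧ Nonempty ((M × N) ≃ₗ[A] (∀ i, F i))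

/-- `f : P → M` is a projective cover: `P` is projective, `f` is surjective and `ker f` is a
superfluous submodule of `P`. -/
structure IsProjectiveCover {P M : ModuleCat.{v} A} (f : P →ₗ[A] M) : Prop where
  projective : Module.Projective A P
  surjective : Function.Surjective f
  superfluous : ∀ N : Submodule A P, N ⊔ LinearMap.ker f = ⊤ → N = ⊤

/-- `Y ≅ Ω(X)`: `Y` is isomorphic to the kernel of a projective cover of `X`. -/
def IsSyzygy (X Y : ModuleCat.{v} A) : Prop :=
  ∃ (P : ModuleCat.{v} A) (f : P →ₗ[A] X),
    IsProjectiveCover f ∧ Nonempty (Y ≃ₗ[A] LinearMap.ker f)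

/-- `Y ≅ Ωⁿ(X)`, where `Ω⁰(X) = X` and `Ωⁿ⁺¹(X) = Ω(Ωⁿ(X))`. -/
def IsNthSyzygy : ℕ → ModuleCat.{v} A → ModuleCat.{v} A → Prop
  | 0, X, Y => Nonempty (Y ≃ₗ[A] X)
  | n + 1, X, Y => ∃ Z : ModuleCat.{v} A, IsNthSyzygy n X Z ∧ IsSyzygy Z Y

/-- There is an exact sequence `0 → W m → ⋯ → W 1 → W 0 → Y → 0` with all `W i` in `add U`
(the sequence is continued by zero modules to the left of `W m`). -/
def HasAddResolution (U : ModuleCat.{v} A) (m : ℕ) (Y : ModuleCat.{v} A) : Prop :=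
  ∃ (W : ℕ → ModuleCat.{v} A) (d : ∀ i, W (i + 1) →ₗ[A] W i) (ε : W 0 →ₗ[A] Y),
    (∀ i ≤ m, InAdd {U} (W i)) ∧ (∀ i, m < i → Subsingleton (W i)) ∧
    Function.Surjective ε ∧ Function.Exact (d 0) ε ∧
    ∀ i, Function.Exact (d (i + 1)) (d i)

variable (A) in
/-- `A` is an `(m,n)`-Igusa–Todorov algebra: some finitely generated module `U` admits, for every
finitely generated `X`, an exact sequence `0 → U_m → ⋯ → U_0 → Ωⁿ(X) → 0` with all `U_i` in
`add U`. -/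
def IsIgusaTodorov (m n : ℕ) : Prop :=
  ∃ U : ModuleCat.{v} A, Module.Finite A U ∧
    ∀ X : ModuleCat.{v} A, Module.Finite A X →
      ∃ Y : ModuleCat.{v} A, IsNthSyzygy n X Y ∧ HasAddResolution U m Y

variable (A) in
/-- The Igusa–Todorov distance of `A`, the infimum in `ℕ ∪ {∞}` of all `m` such that `A` is an
`(m,n)`-Igusa–Todorov algebra for some `n` (it is `∞` if there is no such `m`). -/
noncomputable def itDist : ℕ∞ :=
  ⨅ (m : ℕ) (_ : ∃ n : ℕ, IsIgusaTodorov A m n), (m : ℕ∞)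

/-- The radical of a module: the intersection of its maximal submodules. -/
noncomputable def radObj (M : ModuleCat.{v} A) : ModuleCat.{v} A :=
  ModuleCat.of A (Module.jacobson A M)

/-- The top of a module: `M / rad M`. -/
noncomputable def topObj (M : ModuleCat.{v} A) : ModuleCat.{v} A :=
  ModuleCat.of A (M ⧸ Module.jacobson A M)

/-- The other simple modules, those which are not isomorphic to a member of `V`. -/
def otherSimples (V : Set (ModuleCat.{v} A)) : Set (ModuleCat.{v} A) :=
  {S | IsSimpleModule A S ∧ ∀ T ∈ V, IsEmpty (S ≃ₗ[A] T)}

/-- The torsion class of all finitely generated modules whose top lies in `add` of the simple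
modules outside `V`. -/
def torsionClass (V : Set (ModuleCat.{v} A)) : Set (ModuleCat.{v} A) :=
  {M | Module.Finite A M ∧ InAdd (otherSimples V) (topObj M)}

/-- The torsion radical `t_V(M)`: the sum of all submodules of `M` that lie in the torsion class,
that is, the largest torsion submodule. -/
noncomputable def torsionRadical (V : Set (ModuleCat.{v} A)) (M : ModuleCat.{v} A) :
    Submodule A M :=
  sSup {N : Submodule A M | ModuleCat.of A N ∈ torsionClass V}

/-- `F_{t_V}(M) = rad (t_V(M))`. -/
noncomputable def radTorsion (V : Set (ModuleCat.{v} A)) (M : ModuleCat.{v} A) :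
    ModuleCat.{v} A :=
  radObj (ModuleCat.of A (torsionRadical V M))

/-- The `t_V`-radical layer length: the least `i` with `t_V (F_{t_V}^i (M)) = 0`
(`∞` if there is none). -/
noncomputable def radicalLayerLength (V : Set (ModuleCat.{v} A)) (M : ModuleCat.{v} A) : ℕ∞ :=
  ⨅ (i : ℕ) (_ : torsionRadical V ((radTorsion V)^[i] M) = ⊥), (i : ℕ∞)

/-- The Loewy length: the least `i` with `radⁱ(M) = 0` (`∞` if there is none). -/
noncomputable def loewyLength (M : ModuleCat.{v} A) : ℕ∞ :=
  ⨅ (i : ℕ) (_ : Subsingleton (radObj^[i] M)), (i : ℕ∞)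

end IgusaTodorov

namespace IgusaTodorov

open Function LinearMap

variable {A : Type v} [Ring A]

/-! Let `d` bound the projective dimensions of the simples in `V`, and write `t` and `F = rad ∘ t`
for the torsion radical and the layer functor. A torsion-free module is an iterated extension of
members of `V`, so its projective dimension is at most `d` and it is invisible to high syzygies.
Thus `X` may be replaced by `t(X)`.

Suppose `A` has layer length at most `m + 2`. The projective cover `P` of `t(X)` is again torsion,
so its kernel `K` lies in `rad P = F(P)`. Since `P` embeds in a free module, `K` has layer length at
most `m + 1`: passing to the syzygy gains one.

The chain `K ⊇ F(K) ⊇ F²(K) ⊇ ⋯` then gives `K` a filtration with `m + 1` layers. Each layer `M /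
F(M)` is an extension of the torsion-free `M / t(M)` by the semisimple top of `t(M)`, and the
torsion-free remainder `F^(m+1)(K)` is absorbed by the last layer. Up to projective summands, high
syzygies of the layers are therefore syzygies of semisimple modules, which lie in `add U` when `U`
is the sum of `A` and finitely many syzygies of `A / rad A`. Rotating the extensions turns `m + 1`
layers into a resolution of length `m`, which is the second gain (`Filtered.addResolution`).

Syzygies are handled through `HasSyzygyIn^[n] Q`, which by Schanuel does not depend on presentations
when `Q` is stable; the horseshoe lemma carries statements about extensions through it. Layer
lengths are compared through `IsCogeneratedBy`. The Loewy bound is the case `V = ∅`, and it is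
finite because `A` is Artinian. -/

/-! ### Rotation of short exact sequences and Schanuel's lemma -/

/-- A surjection onto a projective module splits. -/
theorem nonempty_equiv_ker_prod {E P : Type v} [AddCommGroup E] [Module A E] [AddCommGroup P]
    [Module A P] [Module.Projective A P] (g : E →ₗ[A] P) (hg : Surjective g) :
    Nonempty (E ≃ₗ[A] ker g × P) := by
  obtain ⟨l, hl⟩ := Module.projective_lifting_property g LinearMap.id hg
  exact ⟨((LinearMap.exact_subtype_ker_map g).splitSurjectiveEquiv
    (Submodule.subtype_injective _) ⟨l, hl⟩).1⟩

/-- The first term of a short exact sequence is the kernel of its second map. -/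
noncomputable def equivKerOfExact {X' X X'' : Type v} [AddCommGroup X'] [Module A X']
    [AddCommGroup X] [Module A X] [AddCommGroup X''] [Module A X''] {f : X' →ₗ[A] X}
    {g : X →ₗ[A] X''} (hf : Injective f) (h : Exact f g) : X' ≃ₗ[A] ker g :=
  (LinearEquiv.ofInjective f hf).trans (LinearEquiv.ofEq _ _ h.linearMap_ker_eq.symm)

/-- Rotation: given `0 → X' → X → X'' → 0` and an epimorphism `π : P → X''` from a projective
module, there is an epimorphism `X' × P → X` with kernel isomorphic to `ker π`. -/
theorem exists_rotation {X' X X'' P : Type v} [AddCommGroup X'] [Module A X']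
    [AddCommGroup X] [Module A X] [AddCommGroup X''] [Module A X''] [AddCommGroup P] [Module A P]
    [Module.Projective A P] {f : X' →ₗ[A] X} {g : X →ₗ[A] X''} (hf : Injective f)
    (h : Exact f g) (hg : Surjective g) (π : P →ₗ[A] X'') :
    ∃ ψ : X' × P →ₗ[A] X, (Surjective π → Surjective ψ) ∧ Nonempty (ker ψ ≃ₗ[A] ker π) := by
  obtain ⟨l, hl⟩ := Module.projective_lifting_property g π hg
  have hl' : ∀ p, g (l p) = π p := fun p => LinearMap.congr_fun hl p
  have hfg : ∀ x, g (f x) = 0 := fun x => h.apply_apply_eq_zero x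
  -- The lift `l` of `π` through `g` makes `(y, p) ↦ f y + l p` the required map; on its kernel `p`
  -- determines `y`, because `f` is injective.
  refine ⟨f.coprod l, fun hπ x => ?_, ⟨LinearEquiv.ofBijective
    (LinearMap.restrict (LinearMap.snd A X' P) (p := ker (f.coprod l)) (q := ker π) ?_)
    ⟨?_, ?_⟩⟩⟩
  · obtain ⟨p, hp⟩ := hπ (g x)
    obtain ⟨y, hy⟩ := (h (x - l p)).1 (by rw [map_sub, hl', hp, sub_self])
    exact ⟨(y, p), by simp [hy]⟩
  · rintro ⟨x, p⟩ hx
    have : f x + l p = 0 := by simpa using hx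
    have := congrArg g this
    simpa [hfg, hl'] using this
  · rw [injective_iff_map_eq_zero]
    rintro ⟨⟨x, p⟩, hx⟩ h0
    have h1 : f x + l p = 0 := by simpa using hx
    have h2 : p = 0 := congrArg Subtype.val h0
    subst h2
    have : x = 0 := hf (by simpa using h1)
    subst this
    rfl
  · rintro ⟨p, hp⟩
    obtain ⟨y, hy⟩ := (h (l p)).1 (by rw [hl']; exact hp)
    exact ⟨⟨(-y, p), by simp [hy]⟩, rfl⟩

/-- Schanuel's lemma. -/
theorem schanuel {X P P' : Type v} [AddCommGroup X] [Module A X]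
    [AddCommGroup P] [Module A P] [AddCommGroup P'] [Module A P'] [Module.Projective A P]
    [Module.Projective A P'] (f : P →ₗ[A] X) (f' : P' →ₗ[A] X) (hf : Surjective f)
    (hf' : Surjective f') : Nonempty ((ker f × P') ≃ₗ[A] (ker f' × P)) := by
  obtain ⟨ψ, hψ, ⟨e⟩⟩ := exists_rotation (Submodule.subtype_injective (ker f))
    (LinearMap.exact_subtype_ker_map f) hf f'
  obtain ⟨e'⟩ := nonempty_equiv_ker_prod ψ (hψ hf')
  exact ⟨e'.trans (e.prodCongr (LinearEquiv.refl A P))⟩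

/-! ### Syzygies relative to a class of modules -/

/-- A class of modules which is closed under isomorphisms and under adding or removing finitely
generated projective direct summands. -/
structure IsStable (Q : ModuleCat.{v} A → Prop) : Prop where
  iso : ∀ {X Y : ModuleCat.{v} A}, (X ≃ₗ[A] Y) → Q X → Q Y
  prod : ∀ {X P : ModuleCat.{v} A}, Module.Projective A P → Module.Finite A P → Q X →
    Q (ModuleCat.of A (X × P))
  of_prod : ∀ {X P : ModuleCat.{v} A}, Module.Projective A P → Module.Finite A P →
    Q (ModuleCat.of A (X × P)) → Q X

/-- A class of modules which contains the finitely generated projective modules and is closed under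
isomorphisms, finite direct sums and direct summands. -/
structure IsAdditive (Q : ModuleCat.{v} A → Prop) : Prop where
  iso : ∀ {X Y : ModuleCat.{v} A}, (X ≃ₗ[A] Y) → Q X → Q Y
  proj : ∀ {P : ModuleCat.{v} A}, Module.Projective A P → Module.Finite A P → Q P
  prod : ∀ {X Y : ModuleCat.{v} A}, Q X → Q Y → Q (ModuleCat.of A (X × Y))
  of_prod : ∀ {X Y : ModuleCat.{v} A}, Q (ModuleCat.of A (X × Y)) → Q X

theorem IsAdditive.isStable {Q : ModuleCat.{v} A → Prop} (h : IsAdditive Q) : IsStable Q where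
  iso := h.iso
  prod hP hF hX := h.prod hX (h.proj hP hF)
  of_prod _ _ := h.of_prod

/-- The modules `X` with a finitely generated projective presentation `P → X` whose kernel lies
in `Q`. -/
def HasSyzygyIn (Q : ModuleCat.{v} A → Prop) (X : ModuleCat.{v} A) : Prop :=
  ∃ (P : ModuleCat.{v} A) (f : P →ₗ[A] X), Module.Projective A P ∧ Module.Finite A P ∧
    Surjective f ∧ Q (ModuleCat.of A (ker f))

theorem HasSyzygyIn.mono {Q Q' : ModuleCat.{v} A → Prop} (h : ∀ X, Q X → Q' X)
    {X : ModuleCat.{v} A} : HasSyzygyIn Q X → HasSyzygyIn Q' X := by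
  rintro ⟨P, f, h1, h2, h3, h4⟩
  exact ⟨P, f, h1, h2, h3, h _ h4⟩

/-- Schanuel's lemma makes the choice of presentation irrelevant: the two kernels agree after adding
projectives, which a stable class ignores. -/
theorem HasSyzygyIn.ker {Q : ModuleCat.{v} A → Prop} (hQ : IsStable Q) {X P : ModuleCat.{v} A}
    (hX : HasSyzygyIn Q X) (hP : Module.Projective A P) (hF : Module.Finite A P)
    (f : P →ₗ[A] X) (hf : Surjective f) : Q (ModuleCat.of A (ker f)) := by
  obtain ⟨P', f', hP', hF', hf', h⟩ := hX
  obtain ⟨e⟩ := schanuel f' f hf' hf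
  refine hQ.of_prod hP' hF' (hQ.iso ?_ (hQ.prod hP hF h))
  exact e

/-- The kernel of `f × id` is the kernel of `f`. -/
noncomputable def kerProdMapIdEquiv {X Y P : Type v} [AddCommGroup X] [Module A X]
    [AddCommGroup Y] [Module A Y] [AddCommGroup P] [Module A P] (f : X →ₗ[A] Y) :
    ker f ≃ₗ[A] ker (f.prodMap (LinearMap.id : P →ₗ[A] P)) :=
  LinearEquiv.ofBijective
    (LinearMap.restrict (LinearMap.inl A X P) (by intro x hx; simpa using hx))
    ⟨fun x y h => Subtype.ext (congrArg (fun z => z.1.1) h), by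
      rintro ⟨⟨x, p⟩, h⟩
      have h1 : f x = 0 ∧ p = 0 := by simpa using h
      exact ⟨⟨x, h1.1⟩, Subtype.ext (Prod.ext rfl h1.2.symm)⟩⟩

/-- The kernel of a product map is the product of the kernels. -/
noncomputable def kerProdMapEquiv {X Y X' Y' : Type v} [AddCommGroup X] [Module A X]
    [AddCommGroup Y] [Module A Y] [AddCommGroup X'] [Module A X'] [AddCommGroup Y'] [Module A Y']
    (f : X →ₗ[A] Y) (g : X' →ₗ[A] Y') : ker (f.prodMap g) ≃ₗ[A] ker f × ker g :=
  LinearEquiv.ofBijective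
    ((LinearMap.restrict (LinearMap.fst A X X') (by intro x hx; exact (Prod.ext_iff.1 hx).1)).prod
      (LinearMap.restrict (LinearMap.snd A X X') (by intro x hx; exact (Prod.ext_iff.1 hx).2)))
    ⟨fun x y h => Subtype.ext (Prod.ext (congrArg (fun z => z.1.1) h)
        (congrArg (fun z => z.2.1) h)), fun y =>
      ⟨⟨(y.1.1, y.2.1), Prod.ext y.1.2 y.2.2⟩, rfl⟩⟩

theorem IsStable.hasSyzygyIn {Q : ModuleCat.{v} A → Prop} (hQ : IsStable Q) :
    IsStable (HasSyzygyIn Q) where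
  iso := by
    rintro X Y e ⟨P, f, hP, hF, hf, h⟩
    refine ⟨P, e.toLinearMap ∘ₗ f, hP, hF, e.surjective.comp hf, hQ.iso ?_ h⟩
    exact LinearEquiv.ofEq _ _ (by rw [LinearEquiv.ker_comp])
  prod := by
    rintro X P hP hF ⟨P', f, hP', hF', hf, h⟩
    exact ⟨ModuleCat.of A (P' × P), f.prodMap LinearMap.id, inferInstanceAs
      (Module.Projective A (P' × P)), inferInstanceAs (Module.Finite A (P' × P)),
      hf.prodMap surjective_id, hQ.iso (kerProdMapIdEquiv f) h⟩
  of_prod := by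
    rintro X P hP hF h
    have hFX : Module.Finite A (X × P) := by
      obtain ⟨P', f, hP', hF', hf, h⟩ := h
      exact Module.Finite.of_surjective f hf
    have : Module.Finite A X := Module.Finite.of_surjective (LinearMap.fst A X P)
      Prod.fst_surjective
    obtain ⟨n, f, hf⟩ := Module.Finite.exists_fin' A X
    -- Among all presentations of `X × P`, this one has the same kernel as the presentation `f` of
    -- `X`.
    have := h.ker hQ (P := ModuleCat.of A ((Fin n → A) × P))
      (inferInstanceAs (Module.Projective A ((Fin n → A) × P)))
      (inferInstanceAs (Module.Finite A ((Fin n → A) × P)))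
      (f.prodMap LinearMap.id) (hf.prodMap surjective_id)
    exact ⟨ModuleCat.of A (Fin n → A), f, inferInstanceAs (Module.Projective A (Fin n → A)),
      inferInstanceAs (Module.Finite A (Fin n → A)), hf, hQ.iso (kerProdMapIdEquiv f).symm this⟩

theorem IsAdditive.of_subsingleton {Q : ModuleCat.{v} A → Prop} (hQ : IsAdditive Q)
    {X : ModuleCat.{v} A} (h : Subsingleton X) : Q X :=
  hQ.proj (have := Module.Free.of_subsingleton A X; Module.Projective.of_free) inferInstance

theorem IsAdditive.hasSyzygyIn {Q : ModuleCat.{v} A → Prop} (hQ : IsAdditive Q) :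
    IsAdditive (HasSyzygyIn Q) where
  iso := hQ.isStable.hasSyzygyIn.iso
  proj {P} hP hF := ⟨P, LinearMap.id, hP, hF, surjective_id, hQ.of_subsingleton (by
    change Subsingleton (ker (LinearMap.id : P →ₗ[A] P))
    rw [LinearMap.ker_id]
    infer_instance)⟩
  prod := by
    rintro X Y ⟨P, f, hP, hF, hf, h⟩ ⟨P', f', hP', hF', hf', h'⟩
    exact ⟨ModuleCat.of A (P × P'), f.prodMap f', inferInstanceAs
      (Module.Projective A (P × P')), inferInstanceAs (Module.Finite A (P × P')),
      hf.prodMap hf', hQ.iso (kerProdMapEquiv f f').symm (hQ.prod h h')⟩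
  of_prod := by
    rintro X Y h
    have hF : Module.Finite A (X × Y) := by
      obtain ⟨P', f, hP', hF', hf, h⟩ := h
      exact Module.Finite.of_surjective f hf
    have : Module.Finite A X := Module.Finite.of_surjective (LinearMap.fst A X Y)
      Prod.fst_surjective
    have : Module.Finite A Y := Module.Finite.of_surjective (LinearMap.snd A X Y)
      Prod.snd_surjective
    obtain ⟨n, f, hf⟩ := Module.Finite.exists_fin' A X
    obtain ⟨n', f', hf'⟩ := Module.Finite.exists_fin' A Y
    have := h.ker hQ.isStable (P := ModuleCat.of A ((Fin n → A) × (Fin n' → A)))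
      (inferInstanceAs (Module.Projective A ((Fin n → A) × (Fin n' → A))))
      (inferInstanceAs (Module.Finite A ((Fin n → A) × (Fin n' → A))))
      (f.prodMap f') (hf.prodMap hf')
    exact ⟨ModuleCat.of A (Fin n → A), f, inferInstanceAs (Module.Projective A (Fin n → A)),
      inferInstanceAs (Module.Finite A (Fin n → A)), hf,
      hQ.of_prod (Y := ModuleCat.of A (ker f')) (hQ.iso (kerProdMapEquiv f f') this)⟩

theorem IsAdditive.pi {Q : ModuleCat.{v} A → Prop} (hQ : IsAdditive Q) {X : ModuleCat.{v} A}
    (hX : Q X) (n : ℕ) : Q (ModuleCat.of A (Fin n → X)) := by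
  induction n with
  | zero => exact hQ.of_subsingleton (inferInstanceAs (Subsingleton (Fin 0 → X)))
  | succ n ih => exact hQ.iso (Fin.consLinearEquiv A (fun _ : Fin (n + 1) => X)) (hQ.prod hX ih)

/-! ### Extensions and their syzygies -/

/-- `Q` contains each `X` with a short exact sequence `0 → X' → X → X'' → 0` where `X'` lies in `Q'`
and `X''` lies in `Q''`. -/
def ContainsExtensions (Q' Q Q'' : ModuleCat.{v} A → Prop) : Prop :=
  ∀ (X' X X'' : ModuleCat.{v} A) (f : X' →ₗ[A] X) (g : X →ₗ[A] X''), Injective f →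
    Exact f g → Surjective g → Q' X' → Q'' X'' → Q X

/-- The horseshoe lemma. -/
theorem ContainsExtensions.hasSyzygyIn {Q' Q Q'' : ModuleCat.{v} A → Prop}
    (hQ : ContainsExtensions Q' Q Q'') :
    ContainsExtensions (HasSyzygyIn Q') (HasSyzygyIn Q) (HasSyzygyIn Q'') := by
  rintro X' X X'' f g hf h hg ⟨P', π', hP', hF', hπ', h'⟩ ⟨P'', π'', hP'', hF'', hπ'', h''⟩
  obtain ⟨l, hl⟩ := Module.projective_lifting_property g π'' hg
  have hl' : ∀ p, g (l p) = π'' p := fun p => LinearMap.congr_fun hl p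
  have hfg : ∀ x, g (f x) = 0 := fun x => h.apply_apply_eq_zero x
  have key : ∀ x ∈ ker ((f ∘ₗ π').coprod l), x.2 ∈ ker π'' := by
    rintro ⟨p', p''⟩ hx
    have h1 : f (π' p') + l p'' = 0 := by simpa using hx
    simpa [hfg, hl'] using congrArg g h1
  refine ⟨ModuleCat.of A (P' × P''), (f ∘ₗ π').coprod l, inferInstanceAs
      (Module.Projective A (P' × P'')), inferInstanceAs (Module.Finite A (P' × P'')), fun x => ?_,
      hQ (ModuleCat.of A (ker π')) _ (ModuleCat.of A (ker π''))
        (LinearMap.restrict (LinearMap.inl A P' P'') ?_)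
        (LinearMap.restrict (LinearMap.snd A P' P'') key) ?_ ?_ ?_ h' h''⟩
  · obtain ⟨p, hp⟩ := hπ'' (g x)
    obtain ⟨y, hy⟩ := (h (x - l p)).1 (by rw [map_sub, hl', hp, sub_self])
    obtain ⟨y, rfl⟩ := hπ' y
    exact ⟨(y, p), by simp [hy]⟩
  · intro p hp
    have : π' p = 0 := hp
    simp [this]
  · intro x y hxy
    exact Subtype.ext (congrArg (fun z => z.1.1) hxy)
  · rintro ⟨⟨p', p''⟩, hx⟩
    have h1 : f (π' p') + l p'' = 0 := by simpa using hx
    constructor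
    · intro h0
      have h2 : p'' = 0 := congrArg Subtype.val h0
      subst h2
      exact ⟨⟨p', hf (by simpa using h1)⟩, rfl⟩
    · rintro ⟨y, hy⟩
      exact Subtype.ext (congrArg (fun z => z.1.2) hy).symm
  · rintro ⟨p, hp⟩
    obtain ⟨y, hy⟩ := (h (l p)).1 (by rw [hl']; exact hp)
    obtain ⟨y, rfl⟩ := hπ' y
    exact ⟨⟨(-y, p), by simp [hy]⟩, rfl⟩

theorem ContainsExtensions.iterate {Q' Q Q'' : ModuleCat.{v} A → Prop}
    (hQ : ContainsExtensions Q' Q Q'') (n : ℕ) :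
    ContainsExtensions (HasSyzygyIn^[n] Q') (HasSyzygyIn^[n] Q) (HasSyzygyIn^[n] Q'') := by
  induction n with
  | zero => exact hQ
  | succ n ih => simpa only [iterate_succ_apply'] using ih.hasSyzygyIn

theorem IsStable.iterate {Q : ModuleCat.{v} A → Prop} (hQ : IsStable Q) (n : ℕ) :
    IsStable (HasSyzygyIn^[n] Q) := by
  induction n with
  | zero => exact hQ
  | succ n ih => simpa only [iterate_succ_apply'] using ih.hasSyzygyIn

theorem IsAdditive.iterate {Q : ModuleCat.{v} A → Prop} (hQ : IsAdditive Q) (n : ℕ) :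
    IsAdditive (HasSyzygyIn^[n] Q) := by
  induction n with
  | zero => exact hQ
  | succ n ih => simpa only [iterate_succ_apply'] using ih.hasSyzygyIn

/-- The finitely generated projective modules. -/
def IsFGProjective (P : ModuleCat.{v} A) : Prop :=
  Module.Projective A P ∧ Module.Finite A P

variable (A) in
theorem isAdditive_isFGProjective : IsAdditive (IsFGProjective (A := A)) where
  iso e h := ⟨have := h.1; Module.Projective.of_equiv e, have := h.2; Module.Finite.equiv e⟩
  proj h h' := ⟨h, h'⟩
  prod {X Y} h h' := ⟨have := h.1; have := h'.1; inferInstanceAs (Module.Projective A (X × Y)),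
    have := h.2; have := h'.2; inferInstanceAs (Module.Finite A (X × Y))⟩
  of_prod {X Y} h :=
    ⟨have : Module.Projective A (X × Y) := h.1;
      Module.Projective.of_split (LinearMap.inl A X Y) (LinearMap.fst A X Y)
        (LinearMap.fst_comp_inl A X Y),
      have : Module.Finite A (X × Y) := h.2;
      Module.Finite.of_surjective (LinearMap.fst A X Y) Prod.fst_surjective⟩

theorem hasSyzygyIn_iterate_isFGProjective_mono {n m : ℕ} (h : n ≤ m) {X : ModuleCat.{v} A}
    (hX : HasSyzygyIn^[n] IsFGProjective X) : HasSyzygyIn^[m] IsFGProjective X := by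
  have key : ∀ (m : ℕ) (X : ModuleCat.{v} A), HasSyzygyIn^[m] IsFGProjective X →
      HasSyzygyIn^[m + 1] IsFGProjective X := by
    intro m
    induction m with
    | zero => exact fun X h => (isAdditive_isFGProjective A).hasSyzygyIn.proj h.1 h.2
    | succ m ih =>
      intro X h
      rw [iterate_succ_apply'] at h ⊢
      exact h.mono ih
  induction h with
  | refl => exact hX
  | step _ ih => exact key _ _ ih

/-- Extensions by a finitely generated projective quotient split. -/
theorem IsStable.containsExtensions_isFGProjective {Q : ModuleCat.{v} A → Prop}
    (hQ : IsStable Q) : ContainsExtensions Q Q IsFGProjective := by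
  intro X' X X'' f g hf h hg h' h''
  have := h''.1
  obtain ⟨e⟩ := nonempty_equiv_ker_prod g hg
  exact hQ.iso (X := ModuleCat.of A (X' × X''))
    (((equivKerOfExact hf h).prodCongr (LinearEquiv.refl A X'')).trans e.symm)
    (hQ.prod h''.1 h''.2 h')

/-- Rotation moves the projective submodule into the middle term of a presentation of `X`, whose
kernel is that of a presentation of `X''`. Absorbing a projective submodule thus costs one syzygy,
whereas a projective quotient splits off at once. -/
theorem IsStable.isFGProjective_containsExtensions {Q : ModuleCat.{v} A → Prop}
    (hQ : IsStable Q) :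
    ContainsExtensions IsFGProjective (HasSyzygyIn Q) (HasSyzygyIn Q) := by
  rintro X' X X'' f g hf h hg ⟨hP', hF'⟩ ⟨P, π, hP, hF, hπ, hK⟩
  obtain ⟨ψ, hψ, ⟨e⟩⟩ := exists_rotation hf h hg π
  exact ⟨ModuleCat.of A (X' × P), ψ, inferInstanceAs (Module.Projective A (X' × P)),
    inferInstanceAs (Module.Finite A (X' × P)), hψ hπ, hQ.iso e.symm hK⟩

/-! ### Additive closures and resolutions in `add U` -/

theorem inAdd_singleton_iff {U M : ModuleCat.{v} A} :
    InAdd {U} M ↔ ∃ (n : ℕ) (N : ModuleCat.{v} A), Nonempty ((M × N) ≃ₗ[A] (Fin n → U)) := by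
  constructor
  · rintro ⟨n, F, N, hF, h⟩
    obtain rfl : F = fun _ => U := funext hF
    exact ⟨n, N, h⟩
  · rintro ⟨n, N, h⟩
    exact ⟨n, fun _ => U, N, fun _ => rfl, h⟩

theorem InAdd.of_equiv {C : Set (ModuleCat.{v} A)} {M M' : ModuleCat.{v} A} (e : M ≃ₗ[A] M') :
    InAdd C M → InAdd C M' := by
  rintro ⟨n, F, N, hF, ⟨h⟩⟩
  exact ⟨n, F, N, hF, ⟨(e.symm.prodCongr (LinearEquiv.refl A N)).trans h⟩⟩

theorem InAdd.of_prod {C : Set (ModuleCat.{v} A)} {M M' : ModuleCat.{v} A} :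
    InAdd C (ModuleCat.of A (M × M')) → InAdd C M := by
  rintro ⟨n, F, N, hF, ⟨h⟩⟩
  exact ⟨n, F, ModuleCat.of A (M' × N), hF, ⟨(LinearEquiv.prodAssoc A M M' N).symm.trans h⟩⟩

theorem InAdd.prod {U M M' : ModuleCat.{v} A} (h : InAdd {U} M) (h' : InAdd {U} M') :
    InAdd {U} (ModuleCat.of A (M × M')) := by
  rw [inAdd_singleton_iff] at *
  obtain ⟨n, N, ⟨e⟩⟩ := h
  obtain ⟨n', N', ⟨e'⟩⟩ := h'
  exact ⟨n + n', ModuleCat.of A (N × N'), ⟨(LinearEquiv.prodProdProdComm A M M' N N').trans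
    ((e.prodCongr e').trans ((LinearEquiv.sumArrowLequivProdArrow (Fin n) (Fin n') A U).symm.trans
      (LinearEquiv.funCongrLeft A U finSumFinEquiv.symm)))⟩⟩

theorem InAdd.of_subsingleton {C : Set (ModuleCat.{v} A)} {M : ModuleCat.{v} A}
    (h : Subsingleton M) : InAdd C M :=
  ⟨0, fun _ => M, M, fun i => i.elim0, ⟨LinearEquiv.ofSubsingleton _ _⟩⟩

theorem isAdditive_inAdd {U : ModuleCat.{v} A} (hU : InAdd {U} (ModuleCat.of A A)) :
    IsAdditive (InAdd {U}) where
  iso := InAdd.of_equiv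
  proj {P} hP hF := by
    have hpi : ∀ n, InAdd {U} (ModuleCat.of A (Fin n → A)) := by
      intro n
      induction n with
      | zero => exact .of_subsingleton (inferInstanceAs (Subsingleton (Fin 0 → A)))
      | succ n ih =>
        exact (hU.prod ih).of_equiv (Fin.consLinearEquiv A (fun _ : Fin (n + 1) => A))
    obtain ⟨n, f, hf⟩ := Module.Finite.exists_fin' A P
    obtain ⟨e⟩ := nonempty_equiv_ker_prod f hf
    exact InAdd.of_prod (M := P) (M' := ModuleCat.of A (ker f))
      ((hpi n).of_equiv (e.trans (LinearEquiv.prodComm A _ _)))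
  prod := InAdd.prod
  of_prod := InAdd.of_prod

/-- The modules with a resolution of length `m` by modules in `add U`. -/
def AddResolution (U : ModuleCat.{v} A) : ℕ → ModuleCat.{v} A → Prop
  | 0, Y => InAdd {U} Y
  | m + 1, Y => ∃ (W : ModuleCat.{v} A) (f : W →ₗ[A] Y), InAdd {U} W ∧ Surjective f ∧
      AddResolution U m (ModuleCat.of A (ker f))

theorem AddResolution.hasAddResolution {U : ModuleCat.{v} A} {m : ℕ} {Y : ModuleCat.{v} A}
    (h : AddResolution U m Y) : HasAddResolution U m Y := by
  induction m generalizing Y with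
  | zero =>
    refine ⟨fun i => Nat.casesOn i Y fun _ => ModuleCat.of A PUnit, fun i => 0, LinearMap.id, ?_,
      ?_, surjective_id, ?_, ?_⟩
    · intro i hi
      obtain rfl : i = 0 := by omega
      exact h
    · rintro (_ | i) hi
      · omega
      · exact inferInstanceAs (Subsingleton PUnit)
    · intro x
      exact ⟨fun hx => ⟨0, hx.symm⟩, by rintro ⟨y, rfl⟩; rfl⟩
    · intro i x
      exact ⟨fun _ => ⟨0, Subsingleton.elim (α := PUnit) _ _⟩, fun _ => rfl⟩
  | succ m ih =>
    obtain ⟨W₀, f, hW₀, hf, hK⟩ := h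
    obtain ⟨W, d, ε, h1, h2, h3, h4, h5⟩ := ih hK
    -- The resolution of `ker f` is spliced to `f` along the inclusion of the kernel.
    refine ⟨fun i => Nat.casesOn i W₀ W, fun i => match i with
      | 0 => (ker f).subtype ∘ₗ ε
      | i + 1 => d i, f, ?_, ?_, hf, ?_, ?_⟩
    · rintro (_ | i) hi
      · exact hW₀
      · exact h1 i (by omega)
    · rintro (_ | i) hi
      · omega
      · exact h2 i (by omega)
    · intro x
      constructor
      · intro hx
        obtain ⟨y, hy⟩ := h3 ⟨x, hx⟩
        exact ⟨y, congrArg Subtype.val hy⟩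
      · rintro ⟨y, rfl⟩
        exact (ε y).2
    · rintro (_ | i)
      · intro x
        refine Iff.trans ?_ (h4 x)
        exact ⟨fun h => Subtype.ext h, fun h => congrArg Subtype.val h⟩
      · exact h5 i

theorem isStable_addResolution {U : ModuleCat.{v} A} (hU : InAdd {U} (ModuleCat.of A A)) (m : ℕ) :
    IsStable (AddResolution U m) := by
  induction m with
  | zero => exact (isAdditive_inAdd hU).isStable
  | succ m ih =>
    refine ⟨?_, ?_, ?_⟩
    · rintro X Y e ⟨W, f, hW, hf, h⟩
      refine ⟨W, e.toLinearMap ∘ₗ f, hW, e.surjective.comp hf, ih.iso ?_ h⟩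
      exact LinearEquiv.ofEq _ _ (by rw [LinearEquiv.ker_comp])
    · rintro X P hP hF ⟨W, f, hW, hf, h⟩
      exact ⟨ModuleCat.of A (W × P), f.prodMap LinearMap.id,
        hW.prod ((isAdditive_inAdd hU).proj hP hF), hf.prodMap surjective_id,
        ih.iso (kerProdMapIdEquiv f) h⟩
    · rintro X P hP hF ⟨W, f, hW, hf, h⟩
      change W →ₗ[A] X × P at f
      change Surjective f at hf
      obtain ⟨e⟩ := nonempty_equiv_ker_prod (LinearMap.snd A X P ∘ₗ f)
        (Prod.snd_surjective.comp hf)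
      -- The component of `f` in `P` splits, so its kernel is a summand of `W`. The other component
      -- maps this summand onto `X`, again with kernel `ker f`.
      refine ⟨ModuleCat.of A (ker (LinearMap.snd A X P ∘ₗ f)),
        LinearMap.fst A X P ∘ₗ f ∘ₗ Submodule.subtype _,
        InAdd.of_prod (M' := P) (hW.of_equiv e), ?_, ih.iso ?_ h⟩
      · intro x
        obtain ⟨w, hw⟩ := hf (x, 0)
        exact ⟨⟨w, congrArg Prod.snd hw⟩, congrArg Prod.fst hw⟩
      · refine LinearEquiv.ofBijective
          (LinearMap.codRestrict _ (LinearMap.codRestrict _ (ker f).subtype ?_) ?_) ⟨?_, ?_⟩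
        · exact fun x => congrArg Prod.snd x.2
        · exact fun x => congrArg Prod.fst x.2
        · exact fun x y hxy => Subtype.ext (congrArg (fun z => z.1.1) hxy)
        · exact fun y => ⟨⟨y.1.1, Prod.ext y.2 y.1.2⟩, rfl⟩

/-- Rotation gives `0 → Ω X'' → X' × P → X → 0` with middle term in `add U`, so a resolution of the
syzygy of the quotient becomes one of `X`, longer by one. -/
theorem containsExtensions_addResolution_succ {U : ModuleCat.{v} A}
    (hU : InAdd {U} (ModuleCat.of A A)) (m : ℕ) :
    ContainsExtensions (InAdd {U}) (AddResolution U (m + 1))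
      (HasSyzygyIn (AddResolution U m)) := by
  rintro X' X X'' f g hf h hg h' ⟨P, π, hP, hF, hπ, hK⟩
  obtain ⟨ψ, hψ, ⟨e⟩⟩ := exists_rotation hf h hg π
  exact ⟨ModuleCat.of A (X' × P), ψ, h'.prod ((isAdditive_inAdd hU).proj hP hF), hψ hπ,
    (isStable_addResolution hU m).iso e.symm hK⟩

/-! ### Filtrations and the module `U` -/

/-- The modules with a filtration of `k + 1` layers in `Q`. -/
inductive Filtered (Q : ModuleCat.{v} A → Prop) : ℕ → ModuleCat.{v} A → Prop
  | base {X : ModuleCat.{v} A} (h : Q X) : Filtered Q 0 X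
  | step {k : ℕ} {W X Y : ModuleCat.{v} A} (f : W →ₗ[A] X) (g : X →ₗ[A] Y) (hf : Injective f)
      (h : Exact f g) (hg : Surjective g) (hW : Q W) (hY : Filtered Q k Y) : Filtered Q (k + 1) X

/-- A layer may also be added on top. -/
theorem Filtered.step_top {Q : ModuleCat.{v} A → Prop} {k : ℕ} {N X S : ModuleCat.{v} A}
    (f : N →ₗ[A] X) (g : X →ₗ[A] S) (hf : Injective f) (h : Exact f g) (hg : Surjective g)
    (hN : Filtered Q k N) (hS : Q S) : Filtered Q (k + 1) X := by
  induction hN generalizing X with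
  | base hN => exact .step f g hf h hg hN (.base hS)
  | @step k W N Y a b ha hab hb hW hY ih =>
    have hfg : ∀ x, g (f x) = 0 := fun x => h.apply_apply_eq_zero x
    have hab' : ∀ x, b (a x) = 0 := fun x => hab.apply_apply_eq_zero x
    have hle : range (f ∘ₗ a) ≤ ker g := by
      rintro _ ⟨x, rfl⟩
      exact hfg _
    have hker : ker b = range a := hab.linearMap_ker_eq
    have hle' : ker b ≤ ker ((range (f ∘ₗ a)).mkQ ∘ₗ f) := by
      rw [hker]
      rintro _ ⟨x, rfl⟩
      exact (Submodule.Quotient.mk_eq_zero _).2 ⟨x, rfl⟩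
    -- With the bottom layer `W` divided out, `Y = N / W` embeds in `X / W` with quotient `S`, and
    -- the induction hypothesis applies to `X / W`.
    let i : Y →ₗ[A] X ⧸ range (f ∘ₗ a) :=
      ((ker b).liftQ ((range (f ∘ₗ a)).mkQ ∘ₗ f) hle') ∘ₗ
      (b.quotKerEquivOfSurjective hb).symm.toLinearMap
    have hi : ∀ n, i (b n) = (range (f ∘ₗ a)).mkQ (f n) := by
      intro n
      have : (b.quotKerEquivOfSurjective hb).symm (b n) = (ker b).mkQ n := by
        rw [LinearEquiv.symm_apply_eq]
        rfl
      change Submodule.liftQ _ _ hle' ((b.quotKerEquivOfSurjective hb).symm (b n)) = _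
      rw [this]
      rfl
    refine .step (Y := ModuleCat.of A (X ⧸ range (f ∘ₗ a))) (f ∘ₗ a) (range (f ∘ₗ a)).mkQ
      (hf.comp ha) (LinearMap.exact_map_mkQ_range _) (Submodule.mkQ_surjective _) hW
      (ih i ((range (f ∘ₗ a)).liftQ g hle) ?_ ?_ ?_)
    · rw [injective_iff_map_eq_zero]
      intro y hy
      obtain ⟨n, rfl⟩ := hb y
      rw [hi] at hy
      obtain ⟨w, hw⟩ := (Submodule.Quotient.mk_eq_zero _).1 hy
      rw [← hf hw, hab']
    · intro x
      obtain ⟨x, rfl⟩ := Submodule.mkQ_surjective _ x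
      constructor
      · intro hx
        obtain ⟨n, rfl⟩ := (h x).1 hx
        exact ⟨b n, hi n⟩
      · rintro ⟨y, hy⟩
        obtain ⟨n, rfl⟩ := hb y
        rw [hi] at hy
        rw [← hy]
        exact hfg n
    · intro s
      obtain ⟨x, rfl⟩ := hg s
      exact ⟨(range (f ∘ₗ a)).mkQ x, rfl⟩

/-- A module with `k + 1` layers whose syzygies lie in `add U` has syzygies with a resolution of
length `k`. -/
theorem Filtered.addResolution {U : ModuleCat.{v} A} (hU : InAdd {U} (ModuleCat.of A A))
    {N m k : ℕ} {X : ModuleCat.{v} A}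
    (hX : Filtered (fun S => ∀ i ≤ m, HasSyzygyIn^[N + i] (InAdd {U}) S) k X) (i : ℕ)
    (hi : i + k ≤ m) : HasSyzygyIn^[N + i] (AddResolution U k) X := by
  induction hX generalizing i with
  | base h => exact h i hi
  | @step k W X Y f g hf h hg hW hY ih =>
    -- The bottom layer enters with its `(N + i)`-th syzygy, the rest of the filtration with one
    -- syzygy more; hence the budget `i + k ≤ m`.
    refine (containsExtensions_addResolution_succ hU k).iterate (N + i) W X Y f g hf h hg
      (hW i (by omega)) ?_
    have := ih (i + 1) (by omega)
    rwa [← add_assoc, iterate_succ_apply] at this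

/-- Every finitely generated module has a finitely generated `j`-th syzygy. -/
theorem exists_nth_syzygy [IsNoetherianRing A] (X : ModuleCat.{v} A) (hX : Module.Finite A X)
    (j : ℕ) : ∃ Y : ModuleCat.{v} A, Module.Finite A Y ∧
      ∀ Q : ModuleCat.{v} A → Prop, Q Y → HasSyzygyIn^[j] Q X := by
  induction j generalizing X with
  | zero => exact ⟨X, hX, fun Q h => h⟩
  | succ j ih =>
    obtain ⟨n, f, hf⟩ := Module.Finite.exists_fin' A X
    obtain ⟨Y, hY, h⟩ := ih (ModuleCat.of A (ker f)) (inferInstanceAs (Module.Finite A (ker f)))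
    refine ⟨Y, hY, fun Q hQ => ?_⟩
    rw [iterate_succ_apply']
    exact ⟨ModuleCat.of A (Fin n → A), f, inferInstanceAs (Module.Projective A (Fin n → A)),
      inferInstanceAs (Module.Finite A (Fin n → A)), hf, h Q hQ⟩

/-- There is a finitely generated `U` such that `add U` contains the finitely generated projective
modules and a choice of the `N`-th to `(N + m)`-th syzygies of a given module. -/
theorem exists_generator_syzygies [IsNoetherianRing A] (X : ModuleCat.{v} A)
    (hX : Module.Finite A X) (N m : ℕ) : ∃ U : ModuleCat.{v} A, Module.Finite A U ∧
      InAdd {U} (ModuleCat.of A A) ∧ ∀ i ≤ m, HasSyzygyIn^[N + i] (InAdd {U}) X := by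
  have key : ∀ m, ∃ U : ModuleCat.{v} A, Module.Finite A U ∧
      InAdd {U} (ModuleCat.of A A) ∧ ∀ i < m, ∃ Y, InAdd {U} Y ∧
        ∀ Q : ModuleCat.{v} A → Prop, Q Y → HasSyzygyIn^[N + i] Q X := by
    intro m
    have self : ∀ U : ModuleCat.{v} A, InAdd {U} U := fun U => inAdd_singleton_iff.2
      ⟨1, ModuleCat.of A PUnit, ⟨LinearEquiv.prodUnique.trans
        (LinearEquiv.funUnique (Fin 1) A U).symm⟩⟩
    induction m with
    | zero => exact ⟨ModuleCat.of A A, inferInstanceAs (Module.Finite A A), self _, by simp⟩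
    | succ m ih =>
      obtain ⟨U, hU, hUA, h⟩ := ih
      obtain ⟨Y, hY, hYQ⟩ := exists_nth_syzygy X hX (N + m)
      have hmono : ∀ M, InAdd {U} M → InAdd {ModuleCat.of A (U × Y)} M := by
        intro M hM
        obtain ⟨n, N, ⟨e⟩⟩ := inAdd_singleton_iff.1 hM
        refine inAdd_singleton_iff.2 ⟨n, ModuleCat.of A (N × (Fin n → Y)), ⟨?_⟩⟩
        exact (LinearEquiv.prodAssoc A M N (Fin n → Y)).symm.trans
          ((e.prodCongr (LinearEquiv.refl A _)).trans
            { toFun := fun x i => (x.1 i, x.2 i)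
              invFun := fun x => (fun i => (x i).1, fun i => (x i).2)
              map_add' := fun _ _ => rfl
              map_smul' := fun _ _ => rfl
              left_inv := fun _ => rfl
              right_inv := fun _ => rfl })
      refine ⟨ModuleCat.of A (U × Y), inferInstanceAs (Module.Finite A (U × Y)), hmono _ hUA,
        fun i hi => ?_⟩
      rcases Nat.lt_succ_iff_lt_or_eq.1 hi with hi | rfl
      · obtain ⟨Z, hZ, hZQ⟩ := h i hi
        exact ⟨Z, hmono _ hZ, hZQ⟩
      · refine ⟨Y, InAdd.of_prod (M' := U) ((self (ModuleCat.of A (U × Y))).of_equiv ?_), hYQ⟩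
        exact LinearEquiv.prodComm A U Y
  obtain ⟨U, hU, hUA, h⟩ := key (m + 1)
  refine ⟨U, hU, hUA, fun i hi => ?_⟩
  obtain ⟨Y, hY, hYQ⟩ := h i (Nat.lt_succ_of_le hi)
  exact hYQ _ hY

/-- An additive class which contains `A / rad A` contains all finitely generated semisimple
modules. -/
theorem IsAdditive.of_isSemisimpleModule [IsArtinianRing A] {Q : ModuleCat.{v} A → Prop}
    (hQ : IsAdditive Q) (h : Q (ModuleCat.of A (A ⧸ Module.jacobson A A)))
    {S : ModuleCat.{v} A} (hF : Module.Finite A S) (hS : IsSemisimpleModule A S) : Q S := by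
  have hss : IsSemisimpleModule A (A ⧸ Module.jacobson A A) :=
    IsArtinian.isSemisimpleModule_iff_jacobson A _ |>.2 (Module.jacobson_quotient_jacobson A A)
  have : IsArtinian A S := inferInstance
  have hJ : Module.jacobson A S = ⊥ := IsArtinian.isSemisimpleModule_iff_jacobson A S |>.1 hS
  obtain ⟨n, f, hf⟩ := Module.Finite.exists_fin' A S
  -- Since `rad S = 0`, a free cover of `S` factors through a power of `A / rad A`; the resulting
  -- surjection splits by semisimplicity.
  let g : ∀ _ : Fin n, (A ⧸ Module.jacobson A A) →ₗ[A] S := fun i =>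
    (Module.jacobson A A).liftQ (f ∘ₗ LinearMap.single A (fun _ => A) i) (by
      refine (Module.le_comap_jacobson (f ∘ₗ LinearMap.single A (fun _ => A) i)).trans ?_
      rw [hJ]
      exact le_rfl)
  let p : (Fin n → A ⧸ Module.jacobson A A) →ₗ[A] S := LinearMap.lsum A _ ℕ g
  have hp : Surjective p := by
    intro s
    obtain ⟨x, rfl⟩ := hf s
    refine ⟨fun i => (Module.jacobson A A).mkQ (x i), ?_⟩
    have hx : x = ∑ i, LinearMap.single A (fun _ => A) i (x i) :=
      (Finset.univ_sum_single x).symm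
    have hx' : (fun i => (Module.jacobson A A).mkQ (x i)) =
        ∑ i, LinearMap.single A (fun _ => A ⧸ Module.jacobson A A) i
          ((Module.jacobson A A).mkQ (x i)) :=
      (Finset.univ_sum_single _).symm
    rw [hx', map_sum]
    conv_rhs => rw [hx, map_sum]
    refine Finset.sum_congr rfl fun i _ => ?_
    refine (LinearMap.lsum_piSingle ..).trans ?_
    rfl
  obtain ⟨l, hl⟩ := IsSemisimpleModule.lifting_property p hp LinearMap.id
  have e := ((LinearMap.exact_subtype_ker_map p).splitSurjectiveEquiv
    (Submodule.subtype_injective _) ⟨l, hl⟩).1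
  exact hQ.of_prod (Y := ModuleCat.of A (ker p))
    (hQ.iso (e.trans (LinearEquiv.prodComm A _ _)) (hQ.pi h n))

theorem hasSyzygyIn_iterate_of_hasProjectiveDimensionLT [IsNoetherianRing A] (d : ℕ)
    {X : ModuleCat.{v} A} (hF : Module.Finite A X)
    (h : CategoryTheory.HasProjectiveDimensionLT X (d + 1)) :
    HasSyzygyIn^[d] IsFGProjective X := by
  induction d generalizing X with
  | zero =>
    exact ⟨(IsProjective.iff_projective X).2
      (CategoryTheory.projective_iff_hasProjectiveDimensionLT_one.2 h), hF⟩
  | succ d ih =>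
    obtain ⟨n, f, hf⟩ := Module.Finite.exists_fin' A X
    rw [iterate_succ_apply']
    refine ⟨ModuleCat.of A (Fin n → A), f, inferInstanceAs (Module.Projective A (Fin n → A)),
      inferInstanceAs (Module.Finite A (Fin n → A)), hf,
      ih (inferInstanceAs (Module.Finite A (ker f))) ?_⟩
    have hex := LinearMap.exact_subtype_ker_map f
    have hS := ModuleCat.shortComplex_shortExact
      (ModuleCat.shortComplexOfCompEqZero (ker f).subtype f hex.linearMap_comp_eq_zero) hex
      (Submodule.subtype_injective _) hf
    exact (hS.hasProjectiveDimensionLT_X₃_iff d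
      ((IsProjective.iff_projective (Fin n → A)).1 inferInstance)).1 h

theorem exists_comp_eq_of_ker_le {M N K : Type v} [AddCommGroup M] [Module A M]
    [AddCommGroup N] [Module A N] [AddCommGroup K] [Module A K] {p : M →ₗ[A] N}
    (hp : Surjective p) {f : M →ₗ[A] K} (h : ker p ≤ ker f) :
    ∃ g : N →ₗ[A] K, ∀ x, g (p x) = f x := by
  refine ⟨(ker p).liftQ f h ∘ₗ (p.quotKerEquivOfSurjective hp).symm.toLinearMap, fun x => ?_⟩
  have : (p.quotKerEquivOfSurjective hp).symm (p x) = (ker p).mkQ x := by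
    rw [LinearEquiv.symm_apply_eq]
    rfl
  change (ker p).liftQ f h ((p.quotKerEquivOfSurjective hp).symm (p x)) = _
  rw [this]
  rfl

theorem jacobson_le_ker {M S : Type v} [AddCommGroup M] [Module A M] [AddCommGroup S]
    [Module A S] [IsSimpleModule A S] (f : M →ₗ[A] S) : Module.jacobson A M ≤ ker f := by
  rcases f.surjective_or_eq_zero with hf | rfl
  · exact sInf_le (LinearMap.isCoatom_ker_of_surjective hf)
  · simp

/-- Simple modules of finite projective dimension have bounded projective dimension. -/
theorem exists_bound_of_projectiveDimension_lt_top [IsArtinianRing A] (V : Set (ModuleCat.{v} A))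
    (hV : ∀ S ∈ V, IsSimpleModule A S ∧ CategoryTheory.projectiveDimension S < ⊤) :
    ∃ d, ∀ S ∈ V, HasSyzygyIn^[d] IsFGProjective S := by
  have : IsSemisimpleModule A (A ⧸ Module.jacobson A A) :=
    (IsArtinian.isSemisimpleModule_iff_jacobson A _).2 (Module.jacobson_quotient_jacobson A A)
  -- Every simple module is isomorphic to one of the finitely many summands `T i` of `A / rad A`, so
  -- `V` meets finitely many isomorphism classes.
  obtain ⟨n, T, e, hT⟩ :=
    IsSemisimpleModule.exists_linearEquiv_fin_dfinsupp A (A ⧸ Module.jacobson A A)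
  have hd : ∀ i, ∃ d, ∀ S ∈ V, Nonempty (T i ≃ₗ[A] S) → HasSyzygyIn^[d] IsFGProjective S := by
    intro i
    by_cases h : ∃ S ∈ V, Nonempty (T i ≃ₗ[A] S)
    · obtain ⟨S, hS, ⟨e⟩⟩ := h
      obtain ⟨d, hd⟩ := (CategoryTheory.projectiveDimension_ne_top_iff S).1 (hV S hS).2.ne
      have := (hV S hS).1
      refine ⟨d, fun S' _ ⟨e'⟩ => ?_⟩
      exact ((isAdditive_isFGProjective A).iterate d).iso (e.symm.trans e')
        (hasSyzygyIn_iterate_of_hasProjectiveDimensionLT d inferInstance hd)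
    · exact ⟨0, fun S hS he => (h ⟨S, hS, he⟩).elim⟩
  choose d hd using hd
  refine ⟨Finset.univ.sup d, fun S hS => ?_⟩
  have := (hV S hS).1
  have hnt := IsSimpleModule.nontrivial A S
  obtain ⟨s, hs⟩ := exists_ne (0 : S)
  obtain ⟨g, hg⟩ := exists_comp_eq_of_ker_le (Submodule.mkQ_surjective (Module.jacobson A A))
    (f := LinearMap.toSpanSingleton A S s) (by
      rw [Submodule.ker_mkQ]
      exact jacobson_le_ker _)
  have hne : ∃ i, (g ∘ₗ e.symm.toLinearMap) ∘ₗ DFinsupp.lsingle i ≠ 0 := by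
    by_contra! h
    have h0 : g ∘ₗ e.symm.toLinearMap = 0 := DFinsupp.lhom_ext' h
    apply hs
    have h1 := hg 1
    rw [LinearMap.toSpanSingleton_apply, one_smul] at h1
    rw [← h1]
    simpa using LinearMap.congr_fun h0 (e (Submodule.mkQ _ 1))
  obtain ⟨i, hi⟩ := hne
  have := hT i
  exact hasSyzygyIn_iterate_isFGProjective_mono (Finset.le_sup (Finset.mem_univ i))
    (hd i S hS ⟨LinearEquiv.ofBijective _ (LinearMap.bijective_of_ne_zero hi)⟩)

/-! ### The torsion pair and cogeneration -/

/-- `M` is cogenerated by `N`: the homomorphisms from `M` to `N` separate points. -/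
def IsCogeneratedBy (M N : ModuleCat.{v} A) : Prop :=
  ∀ x : M, x ≠ 0 → ∃ f : M →ₗ[A] N, f x ≠ 0

section Torsion

variable {V : Set (ModuleCat.{v} A)}

/-- A map to a simple module factors through the top, and a map between simples is zero or an
isomorphism. This Hom-vanishing form yields all closure properties of the torsion class. -/
theorem mem_torsionClass_iff [IsArtinianRing A] (hV : ∀ S ∈ V, IsSimpleModule A S)
    {M : ModuleCat.{v} A} : M ∈ torsionClass V ↔
      Module.Finite A M ∧ ∀ S ∈ V, ∀ f : M →ₗ[A] S, f = 0 := by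
  constructor
  · rintro ⟨hF, n, F, N, hFs, ⟨e⟩⟩
    refine ⟨hF, fun S hS f => ?_⟩
    have := hV S hS
    obtain ⟨g, hg⟩ := exists_comp_eq_of_ker_le (Submodule.mkQ_surjective (Module.jacobson A M))
      (f := f) (by
        rw [Submodule.ker_mkQ]
        exact jacobson_le_ker _)
    let q : (∀ i, F i) →ₗ[A] S := g ∘ₗ LinearMap.fst A _ N ∘ₗ e.symm.toLinearMap
    have hq : q = 0 := by
      refine LinearMap.pi_ext' fun i => ?_
      by_contra hne
      have := (hFs i).1
      exact ((hFs i).2 S hS).false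
        (LinearEquiv.ofBijective _ (LinearMap.bijective_of_ne_zero hne))
    ext x
    rw [← hg x]
    have h0 : g (e.symm (e ((Module.jacobson A M).mkQ x, 0))).1 = 0 :=
      LinearMap.congr_fun hq (e ((Module.jacobson A M).mkQ x, 0))
    rwa [e.symm_apply_apply] at h0
  · rintro ⟨hF, h⟩
    refine ⟨hF, ?_⟩
    have : IsSemisimpleModule A (M ⧸ Module.jacobson A M) :=
      (IsArtinian.isSemisimpleModule_iff_jacobson A _).2 (Module.jacobson_quotient_jacobson A M)
    obtain ⟨n, T, e, hT⟩ :=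
      IsSemisimpleModule.exists_linearEquiv_fin_dfinsupp A (M ⧸ Module.jacobson A M)
    let e' := e.trans (DFinsupp.linearEquivFunOnFintype (R := A) (M := fun i => T i))
    refine ⟨n, fun i => ModuleCat.of A (T i), ModuleCat.of A PUnit, fun i => ⟨hT i, fun S hS =>
      ⟨fun es => ?_⟩⟩, ⟨LinearEquiv.prodUnique.trans e'⟩⟩
    have h0 := h S hS (es.toLinearMap ∘ₗ LinearMap.proj i ∘ₗ e'.toLinearMap ∘ₗ
      (Module.jacobson A M).mkQ)
    have := hT i
    have hnt := IsSimpleModule.nontrivial A (T i)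
    obtain ⟨t, ht⟩ := exists_ne (0 : T i)
    obtain ⟨x, hx⟩ := Submodule.mkQ_surjective _ (e'.symm (Pi.single i t))
    apply ht
    apply es.injective
    have := LinearMap.congr_fun h0 x
    simpa [hx] using this

theorem mem_torsionClass_of_surjective [IsArtinianRing A] (hV : ∀ S ∈ V, IsSimpleModule A S)
    {M N : ModuleCat.{v} A} (f : M →ₗ[A] N)
    (hf : Surjective f) (hM : M ∈ torsionClass V) : N ∈ torsionClass V := by
  rw [mem_torsionClass_iff hV] at *
  have := hM.1
  refine ⟨Module.Finite.of_surjective f hf, fun S hS g => ?_⟩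
  have := hM.2 S hS (g ∘ₗ f)
  ext x
  obtain ⟨x, rfl⟩ := hf x
  exact LinearMap.congr_fun this x

theorem torsionRadical_le_comap [IsArtinianRing A] (hV : ∀ S ∈ V, IsSimpleModule A S)
    {M N : ModuleCat.{v} A} (f : M →ₗ[A] N) :
    torsionRadical V M ≤ (torsionRadical V N).comap f := by
  refine sSup_le fun K hK => ?_
  rw [← Submodule.map_le_iff_le_comap]
  exact le_sSup (mem_torsionClass_of_surjective hV (M := ModuleCat.of A K)
    (N := ModuleCat.of A (K.map f)) (f.submoduleMap K) (f.submoduleMap_surjective K) hK)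

theorem torsionRadical_mem_torsionClass [IsArtinianRing A] (hV : ∀ S ∈ V, IsSimpleModule A S)
    (M : ModuleCat.{v} A) [Module.Finite A M] :
    ModuleCat.of A (torsionRadical V M) ∈ torsionClass V := by
  rw [mem_torsionClass_iff hV]
  refine ⟨inferInstanceAs (Module.Finite A (torsionRadical V M)), fun S hS f => ?_⟩
  have hle : torsionRadical V M ≤ (ker f).map (torsionRadical V M).subtype := by
    refine sSup_le fun K hK x hx => ?_
    have hKt : K ≤ torsionRadical V M := le_sSup hK
    have := ((mem_torsionClass_iff hV).1 hK).2 S hS (f ∘ₗ Submodule.inclusion hKt)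
    exact ⟨⟨x, hKt hx⟩, LinearMap.congr_fun this ⟨x, hx⟩, rfl⟩
  ext x
  obtain ⟨y, hy, hyx⟩ := hle x.2
  obtain rfl : y = x := Subtype.ext hyx
  exact hy

/-- The preimage in `M` of a torsion submodule of the quotient is torsion: a map from it to a member
of `V` vanishes on `t(M)`, hence factors through a torsion module. The preimage therefore lies in
`t(M)`. -/
theorem torsionRadical_quotient_torsionRadical [IsArtinianRing A] (hV : ∀ S ∈ V, IsSimpleModule A S)
    (M : ModuleCat.{v} A) [Module.Finite A M] :
    torsionRadical V (ModuleCat.of A (M ⧸ torsionRadical V M)) = ⊥ := by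
  refine le_bot_iff.1 (sSup_le fun N hN => ?_)
  have hle : torsionRadical V M ≤ N.comap (torsionRadical V M).mkQ := by
    intro x hx
    have : (torsionRadical V M).mkQ x = 0 := (Submodule.Quotient.mk_eq_zero _).2 hx
    rw [Submodule.mem_comap, this]
    exact N.zero_mem
  have hmem : ModuleCat.of A (N.comap (torsionRadical V M).mkQ) ∈ torsionClass V := by
    rw [mem_torsionClass_iff hV]
    refine ⟨inferInstanceAs (Module.Finite A (N.comap (torsionRadical V M).mkQ)),
      fun S hS f => ?_⟩
    let p : N.comap (torsionRadical V M).mkQ →ₗ[A] N :=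
      (torsionRadical V M).mkQ.restrict fun _ hx => hx
    have hp : Surjective p := by
      rintro ⟨y, hy⟩
      obtain ⟨x, rfl⟩ := Submodule.mkQ_surjective _ y
      exact ⟨⟨x, hy⟩, rfl⟩
    have h0 := ((mem_torsionClass_iff hV).1 (torsionRadical_mem_torsionClass hV M)).2 S hS
      (f ∘ₗ Submodule.inclusion hle)
    obtain ⟨g, hg⟩ := exists_comp_eq_of_ker_le hp (f := f) (by
      rintro ⟨x, hx⟩ hx'
      have hx0 : (torsionRadical V M).mkQ x = 0 := congrArg Subtype.val hx'
      exact LinearMap.congr_fun h0 ⟨x, (Submodule.Quotient.mk_eq_zero _).1 hx0⟩)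
    have := ((mem_torsionClass_iff hV).1 hN).2 S hS g
    ext x
    rw [← hg x, this]
    rfl
  intro y hy
  obtain ⟨x, rfl⟩ := Submodule.mkQ_surjective _ y
  have hx : x ∈ torsionRadical V M := (le_sSup hmem : _ ≤ torsionRadical V M) hy
  exact (Submodule.Quotient.mk_eq_zero _).2 hx

end Torsion

theorem IsCogeneratedBy.of_injective {M N : ModuleCat.{v} A} (f : M →ₗ[A] N) (hf : Injective f) :
    IsCogeneratedBy M N :=
  fun _ hx => ⟨f, (map_ne_zero_iff f hf).2 hx⟩

theorem IsCogeneratedBy.trans {M N K : ModuleCat.{v} A} (h : IsCogeneratedBy M N)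
    (h' : IsCogeneratedBy N K) : IsCogeneratedBy M K := by
  intro x hx
  obtain ⟨f, hf⟩ := h x hx
  obtain ⟨g, hg⟩ := h' _ hf
  exact ⟨g ∘ₗ f, hg⟩

theorem IsCogeneratedBy.subsingleton {M N : ModuleCat.{v} A} (h : IsCogeneratedBy M N)
    (hN : Subsingleton N) : Subsingleton M := by
  refine subsingleton_of_forall_eq 0 fun x => ?_
  by_contra hx
  obtain ⟨f, hf⟩ := h x hx
  exact hf (Subsingleton.elim _ _)

/-- Any homomorphism preserves radicals, so a family separating points restricts to one separating
points of the radicals. Unlike embeddings, cogeneration compares a projective module directly with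
`A` and not with a power of it. -/
theorem IsCogeneratedBy.radObj {M N : ModuleCat.{v} A} (h : IsCogeneratedBy M N) :
    IsCogeneratedBy (radObj M) (radObj N) := by
  rintro ⟨x, hx⟩ hne
  obtain ⟨f, hf⟩ := h x fun h => hne (Subtype.ext h)
  exact ⟨f.restrict (Module.le_comap_jacobson f), fun h0 => hf (congrArg Subtype.val h0)⟩

theorem IsCogeneratedBy.radObj_iterate {M N : ModuleCat.{v} A} (h : IsCogeneratedBy M N) (i : ℕ) :
    IsCogeneratedBy (IgusaTodorov.radObj^[i] M) (IgusaTodorov.radObj^[i] N) := by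
  induction i with
  | zero => exact h
  | succ i ih => simpa only [iterate_succ_apply'] using ih.radObj

/-! ### Projective covers and minimal syzygies -/

/-- A superfluous submodule is contained in the radical. -/
theorem IsProjectiveCover.ker_le_jacobson {P M : ModuleCat.{v} A} {f : P →ₗ[A] M}
    (hf : IsProjectiveCover f) : ker f ≤ Module.jacobson A P := by
  refine le_sInf fun N hN => ?_
  by_contra hle
  exact hN.1 (hf.superfluous N (hN.2 _ (left_lt_sup.2 hle)))

/-- Finitely generated modules over an Artinian ring have projective covers. -/
theorem exists_isProjectiveCover [IsArtinianRing A] (M : ModuleCat.{v} A) [Module.Finite A M] :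
    ∃ (P : ModuleCat.{v} A) (f : P →ₗ[A] M), Module.Finite A P ∧ IsProjectiveCover f := by
  obtain ⟨n, f, hf⟩ := Module.Finite.exists_fin' A M
  -- The cover is a minimal submodule `N` of the free module that still maps onto `M`.
  obtain ⟨N, hN, hmin⟩ := wellFounded_lt.has_min {N : Submodule A (Fin n → A) | N ⊔ ker f = ⊤}
    ⟨⊤, top_sup_eq _⟩
  have hmin' : ∀ K ≤ N, K ⊔ ker f = ⊤ → K = N := fun K hK h =>
    eq_of_le_of_not_lt hK (hmin K h)
  have hiff : ∀ K : Submodule A (Fin n → A), Surjective (f ∘ₗ K.subtype) → K ⊔ ker f = ⊤ := by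
    intro K hK
    refine eq_top_iff.2 fun x _ => ?_
    obtain ⟨y, hy⟩ := hK (f x)
    have hy' : f y = f x := hy
    rw [← add_sub_cancel (y : Fin n → A) x]
    exact Submodule.add_mem_sup y.2 (by rw [LinearMap.mem_ker, map_sub, hy', sub_self])
  have hsurj : Surjective (f ∘ₗ N.subtype) := by
    intro m
    obtain ⟨x, rfl⟩ := hf m
    have hx : x ∈ N ⊔ ker f := by rw [show N ⊔ ker f = ⊤ from hN]; trivial
    obtain ⟨y, hy, z, hz, rfl⟩ := Submodule.mem_sup.1 hx
    exact ⟨⟨y, hy⟩, by simpa using hz⟩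
  -- By minimality `g` restricts to a surjective endomorphism of the Noetherian module `N`, hence to
  -- an automorphism; so `N` is a retract of the free module.
  obtain ⟨g, hg⟩ := Module.projective_lifting_property (f ∘ₗ N.subtype) f hsurj
  have hg' : ∀ x, f (g x) = f x := fun x => LinearMap.congr_fun hg x
  have hgN : Surjective (g ∘ₗ N.subtype) := by
    have : (range (g ∘ₗ N.subtype)).map N.subtype = N := by
      refine hmin' _ (Submodule.map_subtype_le _ _) (hiff _ fun m => ?_)
      obtain ⟨x, rfl⟩ := hsurj m
      exact ⟨⟨g x, Submodule.mem_map_of_mem ⟨x, rfl⟩⟩, hg' x⟩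
    intro y
    have hy : (y : Fin n → A) ∈ (range (g ∘ₗ N.subtype)).map N.subtype := this.symm ▸ y.2
    obtain ⟨_, ⟨x, rfl⟩, hx⟩ := hy
    exact ⟨x, Subtype.ext hx⟩
  have hbij : Bijective (g ∘ₗ N.subtype) :=
    ⟨IsNoetherian.injective_of_surjective_endomorphism _ hgN, hgN⟩
  let e := LinearEquiv.ofBijective _ hbij
  have hproj : Module.Projective A N :=
    Module.Projective.of_split N.subtype (e.symm.toLinearMap ∘ₗ g) (by
      ext1 x
      exact e.symm_apply_apply x)
  refine ⟨ModuleCat.of A N, f ∘ₗ N.subtype, inferInstanceAs (Module.Finite A N),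
    hproj, hsurj, fun K hK => ?_⟩
  have h1 : K.map N.subtype = N := by
    refine hmin' _ (Submodule.map_subtype_le _ _) (hiff _ fun m => ?_)
    obtain ⟨x, rfl⟩ := hsurj m
    have hx : x ∈ K ⊔ ker (f ∘ₗ N.subtype) := by rw [hK]; trivial
    obtain ⟨y, hy, z, hz, rfl⟩ := Submodule.mem_sup.1 hx
    refine ⟨⟨y, Submodule.mem_map_of_mem hy⟩, ?_⟩
    have hz' : (f ∘ₗ N.subtype) z = 0 := hz
    rw [map_add, hz', add_zero]
    rfl
  refine eq_top_iff.2 fun x _ => ?_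
  have hx : (x : Fin n → A) ∈ K.map N.subtype := h1.symm ▸ x.2
  obtain ⟨y, hy, hyx⟩ := hx
  obtain rfl : y = x := Subtype.ext hyx
  exact hy

theorem IsNthSyzygy.of_isSyzygy {n : ℕ} {X Z Y : ModuleCat.{v} A} (hZ : IsSyzygy X Z)
    (hY : IsNthSyzygy n Z Y) : IsNthSyzygy (n + 1) X Y := by
  induction n generalizing Y with
  | zero =>
    obtain ⟨e⟩ := hY
    obtain ⟨P, f, hf, ⟨e'⟩⟩ := hZ
    exact ⟨X, ⟨LinearEquiv.refl A X⟩, P, f, hf, ⟨e.trans e'⟩⟩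
  | succ n ih =>
    obtain ⟨W, hW, hY⟩ := hY
    exact ⟨W, ih hW, hY⟩

/-- Membership of an arbitrary `n`-th syzygy in a stable class passes to the minimal one. -/
theorem exists_isNthSyzygy [IsArtinianRing A] {Q : ModuleCat.{v} A → Prop} (hQ : IsStable Q)
    (n : ℕ) {X : ModuleCat.{v} A} (hF : Module.Finite A X) (h : HasSyzygyIn^[n] Q X) :
    ∃ Y, IsNthSyzygy n X Y ∧ Q Y := by
  induction n generalizing X with
  | zero => exact ⟨X, ⟨LinearEquiv.refl A X⟩, h⟩
  | succ n ih =>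
    rw [iterate_succ_apply'] at h
    obtain ⟨P, f, hP, hf⟩ := exists_isProjectiveCover X
    obtain ⟨Y, hY, hQY⟩ := ih (X := ModuleCat.of A (ker f))
      (inferInstanceAs (Module.Finite A (ker f)))
      (h.ker (hQ.iterate n) hf.projective hP f hf.surjective)
    exact ⟨Y, .of_isSyzygy ⟨P, f, hf, ⟨LinearEquiv.refl A _⟩⟩ hY, hQY⟩

/-! ### Layer lengths and torsion-free modules -/

section Torsion

variable {V : Set (ModuleCat.{v} A)}

theorem IsCogeneratedBy.torsionRadical_eq_bot [IsArtinianRing A]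
    (hV : ∀ S ∈ V, IsSimpleModule A S) {M N : ModuleCat.{v} A} (h : IsCogeneratedBy M N)
    (hN : torsionRadical V N = ⊥) : torsionRadical V M = ⊥ := by
  refine le_bot_iff.1 fun x hx => ?_
  by_contra hne
  obtain ⟨f, hf⟩ := h x hne
  have := torsionRadical_le_comap hV f hx
  rw [hN] at this
  exact hf this

/-- The inclusion of `F_t(M)` into `M`. -/
noncomputable def radTorsionInclusion (V : Set (ModuleCat.{v} A)) (M : ModuleCat.{v} A) :
    radTorsion V M →ₗ[A] M :=
  (torsionRadical V M).subtype ∘ₗ (Module.jacobson A (torsionRadical V M)).subtype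

theorem radTorsionInclusion_injective (V : Set (ModuleCat.{v} A)) (M : ModuleCat.{v} A) :
    Injective (radTorsionInclusion V M) :=
  (Submodule.subtype_injective _).comp (Submodule.subtype_injective _)

theorem IsCogeneratedBy.radTorsion [IsArtinianRing A]
    (hV : ∀ S ∈ V, IsSimpleModule A S) {M N : ModuleCat.{v} A} (h : IsCogeneratedBy M N) :
    IsCogeneratedBy (radTorsion V M) (radTorsion V N) := by
  refine IsCogeneratedBy.radObj ?_
  rintro ⟨x, hx⟩ hne
  obtain ⟨f, hf⟩ := h x fun h => hne (Subtype.ext h)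
  exact ⟨f.restrict (torsionRadical_le_comap hV f), fun h0 => hf (congrArg Subtype.val h0)⟩

theorem IsCogeneratedBy.radTorsion_iterate [IsArtinianRing A]
    (hV : ∀ S ∈ V, IsSimpleModule A S) {M N : ModuleCat.{v} A} (h : IsCogeneratedBy M N) (i : ℕ) :
    IsCogeneratedBy ((IgusaTodorov.radTorsion V)^[i] M)
      ((IgusaTodorov.radTorsion V)^[i] N) := by
  induction i with
  | zero => exact h
  | succ i ih => simpa only [iterate_succ_apply'] using ih.radTorsion hV

theorem isCogeneratedBy_radTorsion_radObj (i : ℕ) (M : ModuleCat.{v} A) :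
    IsCogeneratedBy ((radTorsion V)^[i] M) (radObj^[i] M) := by
  induction i with
  | zero => exact fun x hx => ⟨LinearMap.id, hx⟩
  | succ i ih =>
    rw [iterate_succ_apply', iterate_succ_apply']
    exact (IsCogeneratedBy.of_injective (M := ModuleCat.of A (torsionRadical V _))
      (torsionRadical V _).subtype (Submodule.subtype_injective _)).radObj.trans ih.radObj

theorem radicalLayerLength_le_loewyLength (M : ModuleCat.{v} A) :
    radicalLayerLength V M ≤ loewyLength M := by
  refine le_iInf₂ fun i hi => iInf₂_le i ?_
  have := (isCogeneratedBy_radTorsion_radObj (V := V) i M).subsingleton hi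
  exact Subsingleton.elim (α := Submodule A ((radTorsion V)^[i] M)) _ _

theorem loewyLength_lt_top [IsArtinianRing A] (M : ModuleCat.{v} A) [Module.Finite A M] :
    loewyLength M < ⊤ := by
  have key : ∀ N : Submodule A M, ∃ i, Subsingleton (radObj^[i] (ModuleCat.of A N)) := by
    intro N
    induction N using WellFoundedLT.induction with
    | ind N ih =>
      rcases subsingleton_or_nontrivial N with h | h
      · exact ⟨0, h⟩
      · have hlt : (Module.jacobson A N).map N.subtype < N := by
          refine lt_of_le_of_ne (Submodule.map_subtype_le _ _) fun heq => ?_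
          have h1 := Module.jacobson_lt_top A N
          apply h1.ne
          refine Submodule.map_injective_of_injective N.subtype_injective ?_
          rw [heq, Submodule.map_subtype_top]
        obtain ⟨i, hi⟩ := ih _ hlt
        refine ⟨i + 1, ?_⟩
        rw [iterate_succ_apply]
        refine (IsCogeneratedBy.radObj_iterate ?_ i).subsingleton hi
        exact .of_injective (M := radObj (ModuleCat.of A N))
          (N := ModuleCat.of A ((Module.jacobson A N).map N.subtype))
          (Submodule.equivMapOfInjective N.subtype N.subtype_injective
            (Module.jacobson A N)).toLinearMap (LinearEquiv.injective _)
  obtain ⟨i, hi⟩ := key ⊤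
  have : Subsingleton (radObj^[i] M) := by
    refine (IsCogeneratedBy.radObj_iterate ?_ i).subsingleton hi
    exact .of_injective (N := ModuleCat.of A (⊤ : Submodule A M))
      Submodule.topEquiv.symm.toLinearMap Submodule.topEquiv.symm.injective
  exact (iInf₂_le i this).trans_lt (ENat.natCast_lt_top i)

/-- A class which is closed under extensions and contains `V` contains the torsion-free modules. -/
theorem mem_of_torsionRadical_eq_bot [IsArtinianRing A] (hV : ∀ S ∈ V, IsSimpleModule A S)
    {Q : ModuleCat.{v} A → Prop} (hQ : IsAdditive Q) (hext : ContainsExtensions Q Q Q)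
    (hVQ : ∀ S ∈ V, Q S) (M : ModuleCat.{v} A) [Module.Finite A M]
    (hM : torsionRadical V M = ⊥) : Q M := by
  have key : ∀ N : Submodule A M, Q (ModuleCat.of A N) := by
    intro N
    induction N using WellFoundedLT.induction with
    | ind N ih =>
      rcases subsingleton_or_nontrivial N with h | h
      · exact hQ.of_subsingleton h
      have hN : torsionRadical V (ModuleCat.of A N) = ⊥ :=
        (IsCogeneratedBy.of_injective (M := ModuleCat.of A N) N.subtype
          N.subtype_injective).torsionRadical_eq_bot hV hM
      -- A nonzero torsion-free module is not torsion, so it maps onto some member of `V`; the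
      -- kernel is smaller and the induction descends.
      have hnot : ModuleCat.of A N ∉ torsionClass V := by
        intro hmem
        have h1 : ModuleCat.of A (⊤ : Submodule A N) ∈ torsionClass V :=
          mem_torsionClass_of_surjective hV (M := ModuleCat.of A N)
            Submodule.topEquiv.symm.toLinearMap Submodule.topEquiv.symm.surjective hmem
        have h2 : (⊤ : Submodule A N) ≤ torsionRadical V (ModuleCat.of A N) := le_sSup h1
        rw [hN] at h2
        exact bot_ne_top (le_bot_iff.1 h2).symm
      rw [mem_torsionClass_iff hV] at hnot
      push Not at hnot
      obtain ⟨S, hS, f, hf⟩ := hnot (inferInstanceAs (Module.Finite A N))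
      change N →ₗ[A] S at f
      have := hV S hS
      have hlt : (ker f).map N.subtype < N := by
        refine lt_of_le_of_ne (Submodule.map_subtype_le _ _) fun heq => hf ?_
        rw [← LinearMap.ker_eq_top]
        refine Submodule.map_injective_of_injective N.subtype_injective ?_
        rw [heq, Submodule.map_subtype_top]
      exact hext (ModuleCat.of A (ker f)) (ModuleCat.of A N) S (ker f).subtype f
        (Submodule.subtype_injective _) (LinearMap.exact_subtype_ker_map f)
        (LinearMap.surjective_of_ne_zero hf)
        (hQ.iso (Submodule.equivMapOfInjective N.subtype N.subtype_injective (ker f)).symm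
          (ih _ hlt)) (hVQ S hS)
  exact hQ.iso Submodule.topEquiv (key ⊤)

/-- The layer `M / F_t(M)` is an extension of `M / t(M)` by the top of `t(M)`. -/
theorem ContainsExtensions.quotient_radTorsion {Q' Q Q'' : ModuleCat.{v} A → Prop}
    (hQ : ContainsExtensions Q' Q Q'') {M : ModuleCat.{v} A}
    (h' : Q' (topObj (ModuleCat.of A (torsionRadical V M))))
    (h'' : Q'' (ModuleCat.of A (M ⧸ torsionRadical V M))) :
    Q (ModuleCat.of A (M ⧸ range (radTorsionInclusion V M))) := by
  have hle : range (radTorsionInclusion V M) ≤ ker (torsionRadical V M).mkQ := by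
    rintro _ ⟨x, rfl⟩
    exact (Submodule.Quotient.mk_eq_zero _).2 x.1.2
  have hle' : Module.jacobson A (torsionRadical V M) ≤
      ker ((range (radTorsionInclusion V M)).mkQ ∘ₗ (torsionRadical V M).subtype) :=
    fun x hx => (Submodule.Quotient.mk_eq_zero _).2 ⟨⟨x, hx⟩, rfl⟩
  refine hQ (topObj (ModuleCat.of A (torsionRadical V M))) _ _
    ((Module.jacobson A (torsionRadical V M)).liftQ _ hle')
    ((range (radTorsionInclusion V M)).liftQ (torsionRadical V M).mkQ hle) ?_ ?_ ?_ h' h''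
  · refine (injective_iff_map_eq_zero ((Module.jacobson A (torsionRadical V M)).liftQ _ hle')).2
      fun y hy => ?_
    obtain ⟨x, rfl⟩ := Submodule.mkQ_surjective _ y
    obtain ⟨z, hz⟩ := (Submodule.Quotient.mk_eq_zero _).1 hy
    obtain rfl : z.1 = x := Subtype.ext hz
    exact (Submodule.Quotient.mk_eq_zero _).2 z.2
  · intro y
    obtain ⟨x, rfl⟩ := Submodule.mkQ_surjective _ y
    constructor
    · intro hx
      exact ⟨(Module.jacobson A (torsionRadical V M)).mkQ
        ⟨x, (Submodule.Quotient.mk_eq_zero _).1 hx⟩, rfl⟩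
    · rintro ⟨z, hz⟩
      obtain ⟨z, rfl⟩ := Submodule.mkQ_surjective _ z
      rw [← hz]
      exact (Submodule.Quotient.mk_eq_zero _).2 z.2
  · intro y
    obtain ⟨x, rfl⟩ := Submodule.mkQ_surjective _ y
    exact ⟨(range (radTorsionInclusion V M)).mkQ x, rfl⟩

/-- A projective cover of a torsion module is torsion. -/
theorem IsProjectiveCover.mem_torsionClass [IsArtinianRing A] (hV : ∀ S ∈ V, IsSimpleModule A S)
    {P M : ModuleCat.{v} A} [Module.Finite A P] {f : P →ₗ[A] M} (hf : IsProjectiveCover f)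
    (hM : M ∈ torsionClass V) : P ∈ torsionClass V := by
  rw [mem_torsionClass_iff hV] at *
  refine ⟨inferInstance, fun S hS g => ?_⟩
  have := hV S hS
  -- The kernel of the cover lies in the radical, so every map from `P` to a simple module factors
  -- through `M`.
  obtain ⟨h, hh⟩ := exists_comp_eq_of_ker_le hf.surjective
    (hf.ker_le_jacobson.trans (jacobson_le_ker g))
  ext x
  rw [← hh x, hM.2 S hS h]
  rfl

theorem radObj_isCogeneratedBy_radTorsion [IsArtinianRing A] (hV : ∀ S ∈ V, IsSimpleModule A S)
    {P : ModuleCat.{v} A} (hP : P ∈ torsionClass V) :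
    IsCogeneratedBy (radObj P) (radTorsion V P) := by
  have h1 : ModuleCat.of A (⊤ : Submodule A P) ∈ torsionClass V :=
    mem_torsionClass_of_surjective hV Submodule.topEquiv.symm.toLinearMap
      Submodule.topEquiv.symm.surjective hP
  have h2 : (⊤ : Submodule A P) ≤ torsionRadical V P := le_sSup h1
  exact (IsCogeneratedBy.of_injective (N := ModuleCat.of A (torsionRadical V P))
    (Submodule.inclusion h2 ∘ₗ Submodule.topEquiv.symm.toLinearMap)
    ((Submodule.inclusion_injective h2).comp Submodule.topEquiv.symm.injective)).radObj

theorem IsCogeneratedBy.of_projective {P : ModuleCat.{v} A} (hP : Module.Projective A P)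
    [Module.Finite A P] : IsCogeneratedBy P (ModuleCat.of A A) := by
  intro x hx
  obtain ⟨n, f, hf⟩ := Module.Finite.exists_fin' A P
  obtain ⟨l, hl⟩ := Module.projective_lifting_property f LinearMap.id hf
  by_contra! h
  apply hx
  have h0 : l x = 0 := funext fun i => h (LinearMap.proj i ∘ₗ l)
  have := LinearMap.congr_fun hl x
  rw [LinearMap.comp_apply, h0, map_zero] at this
  exact this.symm

/-- The first syzygy of a torsion module has smaller layer length than the algebra. -/
theorem IsProjectiveCover.torsionRadical_ker [IsArtinianRing A]
    (hV : ∀ S ∈ V, IsSimpleModule A S) {P M : ModuleCat.{v} A} [Module.Finite A P]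
    {f : P →ₗ[A] M} (hf : IsProjectiveCover f) (hM : M ∈ torsionClass V) {i : ℕ}
    (hi : torsionRadical V ((radTorsion V)^[i + 1] (ModuleCat.of A A)) = ⊥) :
    torsionRadical V ((radTorsion V)^[i] (ModuleCat.of A (ker f))) = ⊥ := by
  have h1 : IsCogeneratedBy (ModuleCat.of A (ker f)) (radTorsion V P) :=
    (IsCogeneratedBy.of_injective (N := radObj P) (Submodule.inclusion hf.ker_le_jacobson)
      (Submodule.inclusion_injective _)).trans
      (radObj_isCogeneratedBy_radTorsion hV (hf.mem_torsionClass hV hM))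
  have h2 := (IsCogeneratedBy.of_projective hf.projective).radTorsion hV
  rw [iterate_succ_apply] at hi
  exact ((h1.trans h2).radTorsion_iterate hV i).torsionRadical_eq_bot hV hi

theorem finite_radTorsion [IsNoetherianRing A] (M : ModuleCat.{v} A) [Module.Finite A M] :
    Module.Finite A (radTorsion V M) :=
  Module.Finite.of_injective _ (radTorsionInclusion_injective V M)

end Torsion

/-! ### The bound on the Igusa–Todorov distance -/

variable (A) in
theorem containsExtensions_isFGProjective :
    ContainsExtensions (IsFGProjective (A := A)) IsFGProjective IsFGProjective :=
  (isAdditive_isFGProjective A).isStable.containsExtensions_isFGProjective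

/-- An algebra of `t_V`-radical layer length at most `m + 2` is an `(m, n)`-Igusa–Todorov algebra
for some `n`. -/
theorem exists_isIgusaTodorov [IsArtinianRing A] (V : Set (ModuleCat.{v} A))
    (hV : ∀ S ∈ V, IsSimpleModule A S ∧ CategoryTheory.projectiveDimension S < ⊤) (m : ℕ)
    (hm : torsionRadical V ((radTorsion V)^[m + 2] (ModuleCat.of A A)) = ⊥) :
    ∃ n, IsIgusaTodorov A m n := by
  have hV' : ∀ S ∈ V, IsSimpleModule A S := fun S hS => (hV S hS).1
  obtain ⟨d, hd⟩ := exists_bound_of_projectiveDimension_lt_top V hV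
  have hfree : ∀ n, d ≤ n → ∀ M : ModuleCat.{v} A, Module.Finite A M → torsionRadical V M = ⊥ →
      HasSyzygyIn^[n] IsFGProjective M := fun n hn M _ hM =>
    mem_of_torsionRadical_eq_bot hV' ((isAdditive_isFGProjective A).iterate n)
      ((containsExtensions_isFGProjective A).iterate n)
      (fun S hS => hasSyzygyIn_iterate_isFGProjective_mono hn (hd S hS)) M hM
  have hquot : ∀ n, d ≤ n → ∀ M : ModuleCat.{v} A, Module.Finite A M →
      HasSyzygyIn^[n] IsFGProjective (ModuleCat.of A (M ⧸ torsionRadical V M)) :=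
    fun n hn M _ => hfree n hn _ (inferInstanceAs (Module.Finite A (M ⧸ torsionRadical V M)))
      (torsionRadical_quotient_torsionRadical hV' M)
  -- The shift is `d + 1` and not `d` because the torsion-free submodule left at the end of the
  -- filtration costs one more syzygy to absorb. The range `i ≤ m` covers the `m + 1` layers.
  obtain ⟨U, hUF, hU, hUJ⟩ := exists_generator_syzygies
    (ModuleCat.of A (A ⧸ Module.jacobson A A))
    (inferInstanceAs (Module.Finite A (A ⧸ Module.jacobson A A))) (d + 1) m
  have hadd := isAdditive_inAdd hU
  have htop : ∀ M : ModuleCat.{v} A, Module.Finite A M → ∀ i ≤ m,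
      HasSyzygyIn^[d + 1 + i] (InAdd {U}) (topObj M) := by
    intro M _ i hi
    have hF : Module.Finite A (M ⧸ Module.jacobson A M) := inferInstance
    exact (hadd.iterate (d + 1 + i)).of_isSemisimpleModule (hUJ i hi) hF
      ((IsArtinian.isSemisimpleModule_iff_jacobson A (M ⧸ Module.jacobson A M)).2
        (Module.jacobson_quotient_jacobson A M))
  have hlayer : ∀ M : ModuleCat.{v} A, Module.Finite A M → ∀ i ≤ m,
      HasSyzygyIn^[d + 1 + i] (InAdd {U})
        (ModuleCat.of A (M ⧸ range (radTorsionInclusion V M))) := fun M _ i hi =>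
    (hadd.isStable.containsExtensions_isFGProjective.iterate (d + 1 + i)).quotient_radTorsion
      (htop _ (inferInstanceAs (Module.Finite A (torsionRadical V M))) i hi)
      (hquot _ (by omega) M inferInstance)
  have hfilt : ∀ (k : ℕ) (M : ModuleCat.{v} A), Module.Finite A M →
      torsionRadical V ((radTorsion V)^[k + 1] M) = ⊥ →
      Filtered (fun S => ∀ i ≤ m, HasSyzygyIn^[d + 1 + i] (InAdd {U}) S) k M := by
    intro k
    induction k with
    | zero =>
      intro M _ hM
      refine .base fun i hi => ?_
      -- Here `F(M)` is torsion-free, so its `(d + i)`-th syzygy is projective; one further syzygy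
      -- gives the index `d + 1 + i`.
      have hext := hadd.isStable.isFGProjective_containsExtensions.iterate (d + i)
      have := hext (radTorsion V M) M
        (ModuleCat.of A (M ⧸ range (radTorsionInclusion V M))) (radTorsionInclusion V M) _
        (radTorsionInclusion_injective V M) (LinearMap.exact_map_mkQ_range _)
        (Submodule.mkQ_surjective _) (hfree _ (by omega) _ (finite_radTorsion M) hM)
      rw [← iterate_succ_apply, show (d + i).succ = d + 1 + i by omega] at this
      exact this (hlayer M inferInstance i hi)
    | succ k ih =>
      intro M _ hM
      exact Filtered.step_top (S := ModuleCat.of A (M ⧸ range (radTorsionInclusion V M)))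
        (radTorsionInclusion V M) _ (radTorsionInclusion_injective V M)
        (LinearMap.exact_map_mkQ_range _) (Submodule.mkQ_surjective _)
        (ih _ (finite_radTorsion M) hM) (hlayer M inferInstance)
  -- One syzygy passes from `t(X)` to the kernel of its projective cover; the remaining `d + 1` are
  -- those built into `U`.
  refine ⟨d + 2, U, hUF, fun X hX => ?_⟩
  have hstab := isStable_addResolution hU m
  have htX : HasSyzygyIn^[d + 2] (AddResolution U m) (ModuleCat.of A (torsionRadical V X)) := by
    have hF : Module.Finite A (ModuleCat.of A (torsionRadical V X)) :=
      inferInstanceAs (Module.Finite A (torsionRadical V X))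
    obtain ⟨P, f, hP, hf⟩ := exists_isProjectiveCover (ModuleCat.of A (torsionRadical V X))
    have hker := hfilt m (ModuleCat.of A (ker f)) (inferInstanceAs (Module.Finite A (ker f)))
      (hf.torsionRadical_ker hV' (torsionRadical_mem_torsionClass hV' X) hm)
    rw [iterate_succ_apply']
    exact ⟨P, f, hf.projective, hP, hf.surjective, hker.addResolution hU 0 (by omega)⟩
  have hX' : HasSyzygyIn^[d + 2] (AddResolution U m) X :=
    hstab.containsExtensions_isFGProjective.iterate (d + 2)
      (ModuleCat.of A (torsionRadical V X)) X (ModuleCat.of A (X ⧸ torsionRadical V X))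
      (torsionRadical V X).subtype (torsionRadical V X).mkQ (Submodule.subtype_injective _)
      (LinearMap.exact_subtype_mkQ _) (Submodule.mkQ_surjective _) htX
      (hquot _ (by omega) X hX)
  obtain ⟨Y, hY, hYU⟩ := exists_isNthSyzygy hstab (d + 2) hX hX'
  exact ⟨Y, hY, hYU.hasAddResolution⟩

theorem torsionRadical_iterate_eq_bot_mono [IsArtinianRing A] {V : Set (ModuleCat.{v} A)}
    (hV : ∀ S ∈ V, IsSimpleModule A S) {M : ModuleCat.{v} A} {i j : ℕ} (hij : i ≤ j)
    (h : torsionRadical V ((radTorsion V)^[i] M) = ⊥) :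
    torsionRadical V ((radTorsion V)^[j] M) = ⊥ := by
  induction hij with
  | refl => exact h
  | @step j _ ih =>
    rw [iterate_succ_apply']
    exact (IsCogeneratedBy.of_injective _
      (radTorsionInclusion_injective V _)).torsionRadical_eq_bot hV ih

theorem itDist_le_radicalLayerLength [IsArtinianRing A] (V : Set (ModuleCat.{v} A))
    (hV : ∀ S ∈ V, IsSimpleModule A S ∧ CategoryTheory.projectiveDimension S < ⊤) :
    itDist A ≤ radicalLayerLength V (ModuleCat.of A A) - 2 := by
  have hV' : ∀ S ∈ V, IsSimpleModule A S := fun S hS => (hV S hS).1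
  by_cases h : ∃ i, torsionRadical V ((radTorsion V)^[i] (ModuleCat.of A A)) = ⊥
  · classical
    have hlen : radicalLayerLength V (ModuleCat.of A A) = (Nat.find h : ℕ) :=
      le_antisymm (iInf₂_le (f := fun (i : ℕ) _ => (i : ℕ∞)) (Nat.find h) (Nat.find_spec h))
        (le_iInf₂ fun i hi => Nat.cast_le.2 (Nat.find_min' h hi))
    rw [hlen]
    -- The subtraction is truncated: for layer length below `2` this takes `m = 0`, and monotonicity
    -- supplies the vanishing at index `2`.
    refine (iInf₂_le (Nat.find h - 2) (exists_isIgusaTodorov V hV _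
      (torsionRadical_iterate_eq_bot_mono hV' (by omega) (Nat.find_spec h)))).trans ?_
    norm_cast
  · have hlen : radicalLayerLength V (ModuleCat.of A A) = ⊤ :=
      iInf₂_eq_top.2 fun i hi => (h ⟨i, hi⟩).elim
    rw [hlen]
    exact le_top

theorem itDist_le_loewyLength [IsArtinianRing A] :
    itDist A ≤ loewyLength (ModuleCat.of A A) - 2 :=
  (itDist_le_radicalLayerLength ∅ (by simp)).trans
    (tsub_le_tsub_right (radicalLayerLength_le_loewyLength _) 2)

end IgusaTodorov

theorem theorem1p1 (k : Type u) [CommRing k] [IsArtinianRing k]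
    (A : Type v) [Ring A] [Algebra k A] [Module.Finite k A] :
    (∀ V : Set (ModuleCat.{v} A),
      (∀ S ∈ V, IsSimpleModule A S ∧ CategoryTheory.projectiveDimension S < ⊤) →
      IgusaTodorov.itDist A ≤
        max (IgusaTodorov.radicalLayerLength V (ModuleCat.of A A) - 2) 0) ∧
    IgusaTodorov.itDist A ≤ max (IgusaTodorov.loewyLength (ModuleCat.of A A) - 2) 0 ∧
    IgusaTodorov.itDist A < ⊤ := by
  have : IsArtinianRing A := isArtinian_of_tower k inferInstance
  have : Module.Finite A (ModuleCat.of A A) := inferInstanceAs (Module.Finite A A)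
  exact ⟨fun V hV => (IgusaTodorov.itDist_le_radicalLayerLength V hV).trans (le_max_left _ _),
    IgusaTodorov.itDist_le_loewyLength.trans (le_max_left _ _),
    (IgusaTodorov.itDist_le_loewyLength.trans tsub_le_self).trans_lt
      (IgusaTodorov.loewyLength_lt_top _)⟩
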